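/- Let $r\in(0,1]$, $t>0$, $a\ge 0$. A three-parametric Marcenko--Pastur (MP) density with parameters $(r,t,a)$ is a probability density $\rho$ on $\mathbb R$ whose Green's function $G(z)=\int_{\mathbb R}\frac{\rho(x)}{z-x}\,dx$ satisfies $$z=\frac{1}{G(z)}+\frac{t}{1-rtG(z)}+\frac{a}{(1-rtG(z))^2}\qquad\text{for all } z\in\mathbb C\setminus\mathbb R .$$ Let $$\begin{aligned}S(x)={}&4ax^3-\{8a^2+4a(3r+2)t-t^2\}x^2\\&+2\left[2a^3-2a^2(5r-2)t+a\{r(6r-1)+1\}t^2-(r+1)t^3\right]x\\&+(r-1)^2t^2\{a^2-a(4r-2)t+t^2\},\end{aligned}$$ a polynomial in $x$ of degree $3$ if $a>0$ and $2$ if $a=0$, and put $$g(x)=-2x^3+3\{(2r+1)t+6a\}x^2-3\left[(r-1)\{(2r+1)t-3a\}t-\sqrt{-3S(x)}\right]x+2(r-1)^3t^3,$$ $$\varphi(x)=-\frac23\{x-(r-1)t\}-\frac{2^{1/3}}{3}\,\frac{x^2+\{3a-(2r+1)t\}x+t^2(r-1)^2}{g(x)^{1/3}}-\frac{g(x)^{1/3}}{3\cdot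 2^{1/3}},$$ $$d_\pm=t-a\pm2\sqrt{a\varphi(x)},\qquad d_0=\varphi(x)+x+\frac{t-a}{2}+\frac12\sqrt{d_-d_+},$$ $$f_{\rm L}(x)=\left(\frac{\sqrt{d_-}+\sqrt{d_+}}2-\sqrt{d_0}\right)^2,\qquad f_{\rm R}(x)=\left(\frac{\sqrt{d_-}+\sqrt{d_+}}2+\sqrt{d_0}\right)^2,$$ where $\sqrt{a\varphi}$ and the square roots of $d_\pm$, $d_-d_+$, $d_0$ are principal complex square roots. Then $S$ has at least two real roots counted with multiplicity, and its two largest real roots $x_{\rm L}$, $x_{\rm R}$ (counted with multiplicity) satisfy $0\le x_{\rm L}<x_{\rm R}$. For every $x\in(x_{\rm L},x_{\rm R})$ one has $S(x)<0$, $g(x)>0$, the numbers $f_{\rm L}(x)$ and $f_{\rm R}(x)$ are real, and $f_{\rm L}(x)<x<f_{\rm R}(x)$. The function $$\rho(x;r,t,a)=\frac{\sqrt{(x-f_{\rm L}(x))(f_{\rm R}(x)-x)}}{2\pi rxt}\,\mathbf 1_{(x_{\rm L},x_{\rm R})}(x)$$ is a three-parametric MP density with parameters $(r,t,a)$, and every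 such density is equal to it almost everywhere. Moreover $$-\frac1\pi\lim_{\varepsilon\downarrow0}\operatorname{Im}G(x+i\varepsilon)=\rho(x;r,t,a)$$ for every real $x\neq0$, and also for $x=0$ if $x_{\rm L}>0$. -/

import Mathlib

open MeasureTheory Filter Topology

/-- The Green's function (Stieltjes transform) `G(z) = ∫ ρ(x) / (z - x) dx` of a density `ρ`. -/
noncomputable def greenFn (ρ : ℝ → ℝ) (z : ℂ) : ℂ :=
  ∫ x : ℝ, (ρ x : ℂ) / (z - (x : ℂ))

/-- `ρ` is (a version of) the three-parametric MP density with parameters `r, t, a`: a probability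
density on `ℝ` whose Green's function solves
`z = 1 / G + t / (1 - r t G) + a / (1 - r t G) ^ 2` for every non-real `z`.
(For a probability density, `G z` is non-real when `z` is, so for `r, t ≠ 0` no denominator
vanishes.) -/
structure IsMPDensity (r t a : ℝ) (ρ : ℝ → ℝ) : Prop where
  nonneg : ∀ x, 0 ≤ ρ x
  integrable : Integrable ρ
  integral_eq_one : ∫ x, ρ x = 1
  green_eq : ∀ z : ℂ, z.im ≠ 0 →
    z = 1 / greenFn ρ z + (t : ℂ) / (1 - (r : ℂ) * (t : ℂ) * greenFn ρ z)
      + (a : ℂ) / (1 - (r : ℂ) * (t : ℂ) * greenFn ρ z) ^ 2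

/-- The polynomial `S(x; r, t, a)` in `x`. -/
noncomputable def mpCubic (r t a : ℝ) : Polynomial ℝ :=
  Polynomial.C (4 * a) * Polynomial.X ^ 3
    - Polynomial.C (8 * a ^ 2 + 4 * a * (3 * r + 2) * t - t ^ 2) * Polynomial.X ^ 2
    + Polynomial.C (2 * (2 * a ^ 3 - 2 * a ^ 2 * (5 * r - 2) * t
        + a * (r * (6 * r - 1) + 1) * t ^ 2 - (r + 1) * t ^ 3)) * Polynomial.X
    + Polynomial.C ((r - 1) ^ 2 * t ^ 2 * (a ^ 2 - a * (4 * r - 2) * t + t ^ 2))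

/-- The value `S(x; r, t, a)`. -/
noncomputable def mpS (x r t a : ℝ) : ℝ := (mpCubic r t a).eval x

/-- `u ≤ v` are the two largest real roots of `p`, counted with multiplicity. -/
def IsTwoLargestRoots (p : Polynomial ℝ) (u v : ℝ) : Prop :=
  u ≤ v ∧ ∃ rest : Multiset ℝ, p.roots = u ::ₘ v ::ₘ rest ∧ ∀ w ∈ rest, w ≤ u

/-- `g(x; r, t, a)`, for `S ≤ 0`. -/
noncomputable def mpG (x r t a : ℝ) : ℝ :=
  -2 * x ^ 3 + 3 * ((2 * r + 1) * t + 6 * a) * x ^ 2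
    - 3 * ((r - 1) * ((2 * r + 1) * t - 3 * a) * t - √(-3 * mpS x r t a)) * x
    + 2 * (r - 1) ^ 3 * t ^ 3

/-- `φ(x; r, t, a)`, for `g > 0`. -/
noncomputable def mpPhi (x r t a : ℝ) : ℝ :=
  -(2 / 3) * (x - (r - 1) * t)
    - (2 : ℝ) ^ (1 / 3 : ℝ) / 3
        * ((x ^ 2 + (3 * a - (2 * r + 1) * t) * x + t ^ 2 * (r - 1) ^ 2)
            / mpG x r t a ^ (1 / 3 : ℝ))
    - mpG x r t a ^ (1 / 3 : ℝ) / (3 * (2 : ℝ) ^ (1 / 3 : ℝ))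

/-- `d₋ = t - a - 2 √(a φ)`, a complex number since `φ` is negative on the support;
square roots of complex numbers are principal. -/
noncomputable def mpDMinus (x r t a : ℝ) : ℂ :=
  (t : ℂ) - (a : ℂ) - 2 * Complex.sqrt ((a : ℂ) * (mpPhi x r t a : ℂ))

/-- `d₊ = t - a + 2 √(a φ)`. -/
noncomputable def mpDPlus (x r t a : ℝ) : ℂ :=
  (t : ℂ) - (a : ℂ) + 2 * Complex.sqrt ((a : ℂ) * (mpPhi x r t a : ℂ))

/-- `d₀ = φ + x + (t - a) / 2 + √(d₋ d₊) / 2`. -/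
noncomputable def mpDZero (x r t a : ℝ) : ℂ :=
  (mpPhi x r t a : ℂ) + (x : ℂ) + ((t : ℂ) - (a : ℂ)) / 2
    + 1 / 2 * Complex.sqrt (mpDMinus x r t a * mpDPlus x r t a)

/-- `f_L(x; r, t, a) = ((√d₋ + √d₊) / 2 - √d₀) ^ 2`. -/
noncomputable def mpFL (x r t a : ℝ) : ℂ :=
  ((Complex.sqrt (mpDMinus x r t a) + Complex.sqrt (mpDPlus x r t a)) / 2
    - Complex.sqrt (mpDZero x r t a)) ^ 2

/-- `f_R(x; r, t, a) = ((√d₋ + √d₊) / 2 + √d₀) ^ 2`. -/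
noncomputable def mpFR (x r t a : ℝ) : ℂ :=
  ((Complex.sqrt (mpDMinus x r t a) + Complex.sqrt (mpDPlus x r t a)) / 2
    + Complex.sqrt (mpDZero x r t a)) ^ 2

/-- `√((x - f_L)(f_R - x)) / (2 π r x t)` on `(xL, xR)` and `0` elsewhere. It is applied where
`f_L` and `f_R` are real on `(xL, xR)`. -/
noncomputable def mpFormula (r t a xL xR : ℝ) : ℝ → ℝ :=
  Set.indicator (Set.Ioo xL xR) fun x =>
    √((x - (mpFL x r t a).re) * ((mpFR x r t a).re - x)) / (2 * Real.pi * r * x * t)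

/-! In the variable `w = 1 - r t G` the equation reads `(1 - w) (z w - (1 - r) t - a / w) = r t`, a
cubic in `w`. The physical solution for `Im z > 0` is the one with `Im w > 0` and `Im (z w) > 0`.
Imaginary parts of the equation give `|1 - w|² (|z| + a / |w|²) < r t` for it (`IsBranch.bound`).
Two distinct physical solutions would satisfy `(1 - w₁) (1 - w₂) (z + a / (w₁ w₂)) = r t`, which the
bound and the AM-GM inequality exclude. The confluent form of this argument shows that the explicit
inverse `branchInv` has nonzero derivative there. Hence the physical solution is unique, exists on
the whole half-plane by connectedness, and is holomorphic. The Green's function of any MP density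
must come from it (`IsMPDensity.isBranch`), and Stieltjes inversion gives uniqueness almost
everywhere.

For existence the boundary values are needed. At real `x > 0` the polynomial `S` is the discriminant
of the cubic. If `S ≥ 0`, all roots are real and the density vanishes. If `S < 0`, the roots are
some `w₁ ≤ 0` and a conjugate pair `ω, ω̄` with sum `s` and product `p`. The bound, which survives
in the limit as a non-strict inequality, rules out `w₁`, so the branch tends to the root with
positive imaginary part, and the density is `Im ω / (π r t)`.

The closed formula encodes this root. Cardano's formula gives `φ = -x s`, and the nested square
roots give `f = x (|ω| ∓ |1 - ω|)²`. Heron's formula for the triangle `0, 1, ω` then yields `√((x -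
f_L) (f_R - x)) = 2 x Im ω`.

The bound also gives `|G| ≤ C |z| ^ (-1/2)`, enough for Cauchy's formula on shifted half-planes and
dominated convergence to recover `G` from its boundary density (`eq_greenFn_of_boundary`). The total
mass is read off from `i y G(i y) → 1`. -/

/-- `w` is the physical solution, in the variable `w = 1 - r t G`, of the equation at `z`. -/
structure IsBranch (r t a : ℝ) (z w : ℂ) : Prop where
  im_pos : 0 < w.im
  mul_im_pos : 0 < (z * w).im
  eq : (1 - w) * (z * w - (1 - r) * t - a / w) = r * t

/-! ### The physical branch: uniqueness, existence, holomorphy -/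

section Branch
variable {r t a : ℝ}

/-- Imaginary part of the equation multiplied by the conjugate of `1 - w`. With `mul_im_identity`,
which uses the conjugate of `(1 - w) z`, it forms a linear system in `Im w` and `Im (z w)`. -/
lemma im_identity {z w : ℂ} (h : (1 - w) * (z * w - (1 - r) * t - a / w) = r * t) :
    r * t * w.im = ‖1 - w‖ ^ 2 * ((z * w).im + a / ‖w‖ ^ 2 * w.im) := by
  have h1 : (r * t : ℂ) * (starRingEnd ℂ) (1 - w)
      = ((‖1 - w‖ ^ 2 : ℝ) : ℂ) * (z * w - (1 - r) * t - a / w) := by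
    rw [← h, Complex.sq_norm, Complex.normSq_eq_conj_mul_self]; ring
  have h2 := congrArg Complex.im h1
  rw [Complex.im_ofReal_mul, ← Complex.ofReal_mul, Complex.im_ofReal_mul] at h2
  have h3 : ((a : ℂ) / w).im = - (a / ‖w‖ ^ 2 * w.im) := by
    rw [div_eq_mul_inv, Complex.im_ofReal_mul, Complex.inv_im, Complex.sq_norm]; ring
  have h4 : (((1 : ℂ) - r) * t).im = 0 := by simp
  simp only [Complex.sub_im, h3, h4, Complex.conj_im, Complex.one_im] at h2
  linear_combination h2

lemma mul_im_identity {z w : ℂ} (h : (1 - w) * (z * w - (1 - r) * t - a / w) = r * t) :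
    r * t * ((z * w).im - z.im) =
      ‖1 - w‖ ^ 2 * (‖z‖ ^ 2 * w.im + (1 - r) * t * z.im + a / ‖w‖ ^ 2 * (z * w).im) := by
  have h1 : (r * t : ℂ) * ((starRingEnd ℂ) (1 - w) * (starRingEnd ℂ) z)
      = ((‖1 - w‖ ^ 2 : ℝ) : ℂ) * (((‖z‖ ^ 2 : ℝ) : ℂ) * w
        - (((1 - r) * t : ℝ) : ℂ) * (starRingEnd ℂ) z
        - (a : ℂ) * ((starRingEnd ℂ) z / w)) := by
    rw [← h, Complex.sq_norm, Complex.sq_norm, Complex.normSq_eq_conj_mul_self,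
      Complex.normSq_eq_conj_mul_self]; push_cast; ring
  have h2 := congrArg Complex.im h1
  rw [Complex.im_ofReal_mul, ← Complex.ofReal_mul, Complex.im_ofReal_mul] at h2
  have h3 : ((starRingEnd ℂ) z / w).im = - ((z * w).im / ‖w‖ ^ 2) := by
    rw [Complex.div_im, Complex.sq_norm, Complex.mul_im]; simp; ring
  simp only [Complex.sub_im, Complex.im_ofReal_mul, h3] at h2
  simp only [Complex.mul_im, Complex.conj_im, Complex.conj_re, Complex.sub_im, Complex.sub_re,
    Complex.one_im, Complex.one_re] at h2 ⊢
  linear_combination h2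

lemma one_sub_ne_zero_of_eq (hr0 : 0 < r) (ht : 0 < t) {z w : ℂ}
    (h : (1 - w) * (z * w - (1 - r) * t - a / w) = r * t) : 1 - w ≠ 0 := by
  intro h0
  rw [h0, zero_mul] at h
  have : (r : ℂ) * t ≠ 0 := by
    exact_mod_cast (mul_pos hr0 ht).ne'
  exact this h.symm

/-- If `Im (z w) = 0`, the left side of `mul_im_identity` is negative and the right side positive.
So the sign of `Im (z w)` cannot change along a continuous family of solutions with `Im w > 0`. -/
lemma mul_im_ne_zero (hr0 : 0 < r) (hr1 : r ≤ 1) (ht : 0 < t) {z w : ℂ}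
    (hz : 0 < z.im) (hw : 0 < w.im)
    (h : (1 - w) * (z * w - (1 - r) * t - a / w) = r * t) : (z * w).im ≠ 0 := by
  intro h0
  have h1 := mul_im_identity h
  rw [h0] at h1
  have hz0 : z ≠ 0 := by rintro rfl; simp at hz
  have := norm_pos_iff.2 hz0
  have hN := norm_pos_iff.2 (one_sub_ne_zero_of_eq hr0 ht h)
  have h2 : 0 < ‖1 - w‖ ^ 2 * (‖z‖ ^ 2 * w.im + (1 - r) * t * z.im) := by
    have : 0 ≤ (1 - r) * t * z.im := by
      have : 0 ≤ 1 - r := by linarith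
      positivity
    positivity
  have h3 : 0 < r * t * z.im := by positivity
  nlinarith

/-- With `N = |1 - w|²`, `α = a / |w|²`, `q = Im w` and `p = Im (z w)`, the two identities become
`(r t - N α) q = N p` and `N |z|² q < (r t - N α) p`. Eliminating `p` leaves `(N |z|)² < (r t - N
α)²`, and the first relation makes `r t - N α` positive. -/
lemma IsBranch.bound (hr0 : 0 < r) (hr1 : r ≤ 1) (ht : 0 < t) {z w : ℂ}
    (hz : 0 < z.im) (h : IsBranch r t a z w) :
    ‖1 - w‖ ^ 2 * (‖z‖ + a / ‖w‖ ^ 2) < r * t := by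
  have h1 := mul_im_identity h.eq
  have h2 := im_identity h.eq
  have hz0 : z ≠ 0 := by rintro rfl; simp at hz
  have hzn := norm_pos_iff.2 hz0
  have hN := pow_pos (norm_pos_iff.2 (one_sub_ne_zero_of_eq hr0 ht h.eq)) 2
  have hq := h.im_pos
  have hp := h.mul_im_pos
  set N := ‖1 - w‖ ^ 2
  set q := w.im
  set p := (z * w).im
  set α := a / ‖w‖ ^ 2
  have hc : 0 ≤ (1 - r) * t * z.im := by
    have : 0 ≤ 1 - r := by linarith
    positivity
  have e1 : (r * t - N * α) * q = N * p := by linear_combination h2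
  have e2 : N * ‖z‖ ^ 2 * q < (r * t - N * α) * p := by
    have : (r * t - N * α) * p
      = N * ‖z‖ ^ 2 * q + (r * t * z.im + N * ((1 - r) * t * z.im)) := by
      linear_combination h1
    rw [this]
    have : 0 < r * t * z.im := by positivity
    have : 0 ≤ N * ((1 - r) * t * z.im) := by positivity
    linarith
  have e3 : 0 < r * t - N * α := by
    by_contra hneg
    have : (r * t - N * α) * q ≤ 0 := mul_nonpos_of_nonpos_of_nonneg (not_lt.1 hneg) hq.le
    have : 0 < N * p := by positivity
    linarith
  have e4 : (N * ‖z‖) ^ 2 * q < (r * t - N * α) ^ 2 * q := by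
    calc (N * ‖z‖) ^ 2 * q = N * (N * ‖z‖ ^ 2 * q) := by ring
      _ < N * ((r * t - N * α) * p) := by gcongr
      _ = (r * t - N * α) * (N * p) := by ring
      _ = (r * t - N * α) ^ 2 * q := by rw [← e1]; ring
  have e5 := lt_of_mul_lt_mul_right e4 hq.le
  have e6 := lt_of_pow_lt_pow_left₀ 2 e3.le e5
  linarith

/-- AM-GM on the `z` term and on the `a` term separately bounds the mixed expression by the mean of
the two diagonal ones. -/
lemma norm_prod_lt_of_bound (ha : 0 ≤ a) {R : ℝ} {z w₁ w₂ : ℂ}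
    (h₁ : ‖1 - w₁‖ ^ 2 * (‖z‖ + a / ‖w₁‖ ^ 2) < R) (h₂ : ‖1 - w₂‖ ^ 2 * (‖z‖ + a / ‖w₂‖ ^ 2) < R) :
    ‖(1 - w₁) * (1 - w₂) * (z + a / (w₁ * w₂))‖ < R := by
  have h : ‖(1 - w₁) * (1 - w₂) * (z + a / (w₁ * w₂))‖
      ≤ ‖1 - w₁‖ * ‖1 - w₂‖ * (‖z‖ + a / (‖w₁‖ * ‖w₂‖)) := by
    rw [norm_mul, norm_mul]
    gcongr
    refine (norm_add_le _ _).trans ?_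
    rw [norm_div, norm_mul, Complex.norm_real, Real.norm_of_nonneg ha]
  refine h.trans_lt ?_
  have e1 : ‖1 - w₁‖ * ‖1 - w₂‖ * ‖z‖ ≤ (‖1 - w₁‖ ^ 2 + ‖1 - w₂‖ ^ 2) / 2 * ‖z‖ := by
    gcongr
    nlinarith [sq_nonneg (‖1 - w₁‖ - ‖1 - w₂‖)]
  have e2 : a * ((‖1 - w₁‖ / ‖w₁‖) * (‖1 - w₂‖ / ‖w₂‖))
      ≤ a * (((‖1 - w₁‖ / ‖w₁‖) ^ 2 + (‖1 - w₂‖ / ‖w₂‖) ^ 2) / 2) := by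
    gcongr
    nlinarith [sq_nonneg (‖1 - w₁‖ / ‖w₁‖ - ‖1 - w₂‖ / ‖w₂‖)]
  have e3 : ‖1 - w₁‖ * ‖1 - w₂‖ * (‖z‖ + a / (‖w₁‖ * ‖w₂‖))
      = ‖1 - w₁‖ * ‖1 - w₂‖ * ‖z‖ + a * ((‖1 - w₁‖ / ‖w₁‖) * (‖1 - w₂‖ / ‖w₂‖)) := by
    field_simp
  have e4 : ∀ w : ℂ, ‖1 - w‖ ^ 2 * (‖z‖ + a / ‖w‖ ^ 2)
      = ‖1 - w‖ ^ 2 * ‖z‖ + a * (‖1 - w‖ / ‖w‖) ^ 2 := by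
    intro w; rw [div_pow]; ring
  rw [e4] at h₁ h₂
  linarith

lemma ne_zero_of_im_pos {w : ℂ} (h : 0 < w.im) : w ≠ 0 := by
  rintro rfl; simp at h

/-- Eliminating between the two equations leaves a factor `w₁ - w₂`; its cofactor forces the mixed
product to equal `r t` exactly, against `norm_prod_lt_of_bound`. -/
lemma IsBranch.unique (hr0 : 0 < r) (hr1 : r ≤ 1) (ht : 0 < t) (ha : 0 ≤ a) {z w₁ w₂ : ℂ}
    (hz : 0 < z.im) (h₁ : IsBranch r t a z w₁) (h₂ : IsBranch r t a z w₂) : w₁ = w₂ := by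
  by_contra hne
  have hb := norm_prod_lt_of_bound ha (h₁.bound hr0 hr1 ht hz) (h₂.bound hr0 hr1 ht hz)
  have n1 := ne_zero_of_im_pos h₁.im_pos
  have n2 := ne_zero_of_im_pos h₂.im_pos
  have e : (1 - w₁) * (1 - w₂) * (z + a / (w₁ * w₂)) = r * t := by
    have e1 := h₁.eq
    have e2 := h₂.eq
    have : (w₁ - w₂) * ((1 - w₁) * (1 - w₂) * (z + a / (w₁ * w₂))) = (w₁ - w₂) * (r * t) := by
      have e3 : (w₁ - w₂) * (a / (w₁ * w₂)) = a / w₂ - a / w₁ := by field_simp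
      linear_combination (1 - w₂) * e1 - (1 - w₁) * e2 + (1 - w₁) * (1 - w₂) * e3
    exact mul_left_cancel₀ (sub_ne_zero.2 hne) this
  rw [e, ← Complex.ofReal_mul, Complex.norm_real, Real.norm_of_nonneg (by positivity)] at hb
  exact lt_irrefl _ hb

/-- The inverse function of the physical branch. -/
noncomputable def branchInv (r t a : ℝ) (w : ℂ) : ℂ := r * t / (1 - w) + t / w + a / w ^ 2

lemma eq_iff_branchInv (hr0 : 0 < r) (ht : 0 < t) {z w : ℂ} (hw : w ≠ 0) :
    (1 - w) * (z * w - (1 - r) * t - a / w) = r * t ↔ 1 - w ≠ 0 ∧ branchInv r t a w = z := by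
  constructor
  · intro h
    have h1 := one_sub_ne_zero_of_eq hr0 ht h
    refine ⟨h1, ?_⟩
    unfold branchInv
    field_simp at h ⊢
    linear_combination -h
  · rintro ⟨h1, rfl⟩
    unfold branchInv
    field_simp
    ring

lemma hasStrictDerivAt_branchInv {w : ℂ} (hw : w ≠ 0) (h1 : 1 - w ≠ 0) :
    HasStrictDerivAt (branchInv r t a)
      (r * t / (1 - w) ^ 2 - t / w ^ 2 - 2 * a / w ^ 3) w := by
  have e1 : HasStrictDerivAt (fun w : ℂ => 1 - w) (-1) w := by
    simpa using (hasStrictDerivAt_id w).const_sub 1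
  have e2 := ((hasStrictDerivAt_const w (r * t : ℂ)).fun_div e1 h1).fun_add
    ((hasStrictDerivAt_const w (t : ℂ)).fun_div (hasStrictDerivAt_id w) hw)
  have e3 := e2.fun_add ((hasStrictDerivAt_const w (a : ℂ)).fun_div
    ((hasStrictDerivAt_id w).fun_pow 2) (pow_ne_zero 2 hw))
  refine e3.congr_deriv ?_
  simp only [id]
  field_simp
  ring

/-- The case `w₁ = w₂` of the uniqueness argument: a zero derivative means `(1 - w)² (z + a / w²) =
r t`. -/
lemma IsBranch.deriv_ne_zero (hr0 : 0 < r) (hr1 : r ≤ 1) (ht : 0 < t) (ha : 0 ≤ a) {z w : ℂ}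
    (hz : 0 < z.im) (h : IsBranch r t a z w) :
    (r * t / (1 - w) ^ 2 - t / w ^ 2 - 2 * a / w ^ 3 : ℂ) ≠ 0 := by
  intro hd
  have hb := norm_prod_lt_of_bound ha (h.bound hr0 hr1 ht hz) (h.bound hr0 hr1 ht hz)
  have n1 := ne_zero_of_im_pos h.im_pos
  have n2 := one_sub_ne_zero_of_eq hr0 ht h.eq
  have e : (1 - w) * (1 - w) * (z + a / (w * w)) = r * t := by
    obtain ⟨-, hz'⟩ := (eq_iff_branchInv hr0 ht n1).1 h.eq
    rw [← hz']
    unfold branchInv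
    field_simp at hd ⊢
    linear_combination -hd
  rw [e, ← Complex.ofReal_mul, Complex.norm_real, Real.norm_of_nonneg (by positivity)] at hb
  exact lt_irrefl _ hb

/-- The term `a / w` requires a limit away from `0`. For `a ≠ 0`, clearing the denominator and
putting `ω = 0` would give `a = 0`; for `a = 0` it would give `t = 0`. -/
lemma limit_of_eq (hr0 : 0 < r) (ht : 0 < t) {ι : Type*}
    {l : Filter ι} [l.NeBot] {z w : ι → ℂ} {ζ ω : ℂ} (hz : Tendsto z l (𝓝 ζ))
    (hw : Tendsto w l (𝓝 ω)) (hw0 : ∀ i, w i ≠ 0)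
    (h : ∀ i, (1 - w i) * (z i * w i - (1 - r) * t - a / w i) = r * t) :
    ω ≠ 0 ∧ (1 - ω) * (ζ * ω - (1 - r) * t - a / ω) = r * t := by
  have hrt : (r : ℂ) * t ≠ 0 := by exact_mod_cast (mul_pos hr0 ht).ne'
  rcases eq_or_ne a 0 with rfl | ha
  · have e : (1 - ω) * (ζ * ω - (1 - r) * t) = r * t := by
      refine tendsto_nhds_unique
        (((tendsto_const_nhds.sub hw).mul ((hz.mul hw).sub_const ((1 - r) * t : ℂ)))) ?_
      refine tendsto_const_nhds.congr fun i => ?_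
      have := h i
      simp only [Complex.ofReal_zero, zero_div, sub_zero] at this
      exact this.symm
    refine ⟨?_, by simpa using e⟩
    rintro rfl
    have : (t : ℂ) = 0 := by linear_combination -e
    exact ht.ne' (by exact_mod_cast this)
  · have e : (1 - ω) * (ζ * ω ^ 2 - (1 - r) * t * ω - a) = r * t * ω := by
      refine tendsto_nhds_unique
        (((tendsto_const_nhds.sub hw).mul
          (((hz.mul (hw.pow 2)).sub (hw.const_mul ((1 - r) * t : ℂ))).sub_const (a : ℂ)))) ?_
      refine (hw.const_mul (r * t : ℂ)).congr fun i => ?_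
      rw [← h i]
      have := hw0 i
      field_simp
    have h0 : ω ≠ 0 := by
      rintro rfl
      have : (a : ℂ) = 0 := by linear_combination -e
      exact ha (by exact_mod_cast this)
    refine ⟨h0, ?_⟩
    field_simp
    linear_combination e

lemma im_ne_zero_of_eq (hr0 : 0 < r) (ht : 0 < t) {z w : ℂ} (hz : z.im ≠ 0) (hw0 : w ≠ 0)
    (h : (1 - w) * (z * w - (1 - r) * t - a / w) = r * t) : w.im ≠ 0 := by
  intro h0
  obtain ⟨-, hz'⟩ := (eq_iff_branchInv hr0 ht hw0).1 h
  have : w = (w.re : ℂ) := by apply Complex.ext <;> simp [h0]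
  apply hz
  rw [← hz', this, branchInv]
  have : (r * t / (1 - (w.re : ℂ)) + t / (w.re : ℂ) + a / (w.re : ℂ) ^ 2 : ℂ)
    = ((r * t / (1 - w.re) + t / w.re + a / w.re ^ 2 : ℝ) : ℂ) := by push_cast; rfl
  rw [this, Complex.ofReal_im]

lemma IsBranch.norm_sq_le (hr0 : 0 < r) (hr1 : r ≤ 1) (ht : 0 < t) (ha : 0 ≤ a) {z w : ℂ}
    (hz : 0 < z.im) (h : IsBranch r t a z w) : ‖1 - w‖ ^ 2 * ‖z‖ ≤ r * t := by
  have := h.bound hr0 hr1 ht hz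
  have : 0 ≤ ‖1 - w‖ ^ 2 * (a / ‖w‖ ^ 2) := by positivity
  linarith

/-- Limits of branch values solve the limiting equation, with a non-strict bound. -/
lemma IsBranch.limit (hr0 : 0 < r) (hr1 : r ≤ 1) (ht : 0 < t) {ι : Type*}
    {l : Filter ι} [l.NeBot] {z w : ι → ℂ} {ζ ω : ℂ} (hz : Tendsto z l (𝓝 ζ))
    (hw : Tendsto w l (𝓝 ω)) (hzi : ∀ i, 0 < (z i).im) (h : ∀ i, IsBranch r t a (z i) (w i)) :
    ω ≠ 0 ∧ (1 - ω) * (ζ * ω - (1 - r) * t - a / ω) = r * t ∧ 0 ≤ ω.im ∧ 0 ≤ (ζ * ω).im ∧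
      ‖1 - ω‖ ^ 2 * (‖ζ‖ + a / ‖ω‖ ^ 2) ≤ r * t := by
  obtain ⟨h0, he⟩ := limit_of_eq hr0 ht hz hw (fun i => ne_zero_of_im_pos (h i).im_pos)
    fun i => (h i).eq
  refine ⟨h0, he, ?_, ?_, ?_⟩
  · exact ge_of_tendsto ((Complex.continuous_im.tendsto _).comp hw)
      (Eventually.of_forall fun i => (h i).im_pos.le)
  · exact ge_of_tendsto ((Complex.continuous_im.tendsto _).comp (hz.mul hw))
      (Eventually.of_forall fun i => (h i).mul_im_pos.le)
  · refine le_of_tendsto (x := l) (f := fun i => ‖1 - w i‖ ^ 2 * (‖z i‖ + a / ‖w i‖ ^ 2)) ?_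
      (Eventually.of_forall fun i => ((h i).bound hr0 hr1 ht (hzi i)).le)
    refine ((tendsto_const_nhds.sub hw).norm.pow 2).mul (hz.norm.add ?_)
    exact tendsto_const_nhds.div (hw.norm.pow 2) (pow_ne_zero 2 (norm_ne_zero_iff.2 h0))

/-- Branch values stay bounded as long as `z` stays away from `0`. -/
lemma IsBranch.exists_subseq (hr0 : 0 < r) (hr1 : r ≤ 1) (ht : 0 < t) (ha : 0 ≤ a)
    {z w : ℕ → ℂ} {ζ : ℂ} (hζ : ζ ≠ 0) (hz : Tendsto z atTop (𝓝 ζ))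
    (hzi : ∀ i, 0 < (z i).im) (h : ∀ i, IsBranch r t a (z i) (w i)) :
    ∃ ω, ∃ φ : ℕ → ℕ, StrictMono φ ∧ Tendsto (w ∘ φ) atTop (𝓝 ω) := by
  have hζ' := norm_pos_iff.2 hζ
  have ev : ∀ᶠ i in atTop, w i ∈ Metric.closedBall (1 : ℂ) (r * t / (‖ζ‖ / 2) + 1) := by
    filter_upwards [hz.norm.eventually_const_lt (half_lt_self hζ')] with i hi
    rw [Metric.mem_closedBall, dist_comm, dist_eq_norm]
    have h1 := (h i).norm_sq_le hr0 hr1 ht ha (hzi i)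
    have h2 : ‖1 - w i‖ ^ 2 ≤ r * t / (‖ζ‖ / 2) := by
      rw [le_div_iff₀ (by positivity)]
      refine le_trans ?_ h1
      gcongr
    nlinarith [sq_nonneg (‖1 - w i‖ - 1), norm_nonneg (1 - w i)]
  obtain ⟨ω, -, φ, hφ, hω⟩ := tendsto_subseq_of_frequently_bounded Metric.isBounded_closedBall
    ev.frequently
  exact ⟨ω, φ, hφ, hω⟩

lemma IsBranch.limit_isBranch (hr0 : 0 < r) (hr1 : r ≤ 1) (ht : 0 < t) {ι : Type*}
    {l : Filter ι} [l.NeBot] {z w : ι → ℂ} {ζ ω : ℂ} (hz : Tendsto z l (𝓝 ζ))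
    (hw : Tendsto w l (𝓝 ω)) (hzi : ∀ i, 0 < (z i).im) (h : ∀ i, IsBranch r t a (z i) (w i))
    (hζ : 0 < ζ.im) : IsBranch r t a ζ ω := by
  obtain ⟨h0, he, h1, h2, -⟩ := IsBranch.limit hr0 hr1 ht hz hw hzi h
  have h3 := h1.lt_of_ne' (im_ne_zero_of_eq hr0 ht hζ.ne' h0 he)
  exact ⟨h3, h2.lt_of_ne' (mul_im_ne_zero hr0 hr1 ht hζ h3 he), he⟩

/-- Starting point of the continuation: near `w = 1` the term `r t / (1 - w) = i r t / η` dominates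
both imaginary parts. -/
lemma isBranch_branchInv_of_small (ht : 0 < t) (ha : 0 ≤ a) {η : ℝ}
    (hη : 0 < η) (hη1 : (t + 2 * a) * η ^ 2 < r * t) :
    0 < (branchInv r t a (1 + η * Complex.I)).im ∧
      0 < (branchInv r t a (1 + η * Complex.I) * (1 + η * Complex.I)).im := by
  have hD : 1 ≤ 1 + η ^ 2 := by nlinarith [sq_nonneg η]
  have hD0 : (0 : ℝ) < 1 + η ^ 2 := by positivity
  have hI : Complex.I ^ 2 = -1 := Complex.I_sq
  have hw : (1 + η * Complex.I : ℂ) ≠ 0 := ne_zero_of_im_pos (by simpa using hη)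
  have hηc : (η : ℂ) ≠ 0 := by exact_mod_cast hη.ne'
  have hDc : (1 + (η : ℂ) ^ 2) ≠ 0 := by exact_mod_cast hD0.ne'
  have inv1 : (1 + η * Complex.I : ℂ)⁻¹ = (((1 + η ^ 2)⁻¹ : ℝ) : ℂ) * (1 - η * Complex.I) := by
    push_cast
    rw [inv_eq_iff_eq_inv, mul_inv, inv_inv, eq_mul_inv_iff_mul_eq₀]
    · linear_combination -(η : ℂ) ^ 2 * hI
    · intro h0
      have := congrArg Complex.im h0
      simp at this; exact hη.ne' this
  have inv2 : (1 - (1 + η * Complex.I) : ℂ)⁻¹ = ((η⁻¹ : ℝ) : ℂ) * Complex.I := by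
    push_cast
    rw [inv_eq_iff_eq_inv, mul_inv, inv_inv, Complex.inv_I]; ring
  have e : branchInv r t a (1 + η * Complex.I) =
      ((r * t * η⁻¹ : ℝ) : ℂ) * Complex.I
        + ((t * (1 + η ^ 2)⁻¹ : ℝ) : ℂ) * (1 - η * Complex.I)
        + ((a * (1 + η ^ 2)⁻¹ ^ 2 : ℝ) : ℂ) * (1 - η * Complex.I) ^ 2 := by
    unfold branchInv
    rw [div_eq_mul_inv, div_eq_mul_inv, div_eq_mul_inv, ← inv_pow, inv1, inv2]
    push_cast; ring
  have k1 : (1 + η ^ 2)⁻¹ ≤ 1 := inv_le_one_of_one_le₀ hD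
  have k0 : 0 < (1 + η ^ 2)⁻¹ := inv_pos.2 hD0
  have k3 : (1 + η ^ 2)⁻¹ * (1 + η ^ 2) = 1 := inv_mul_cancel₀ hD0.ne'
  set k := (1 + η ^ 2)⁻¹
  have k2 : k ^ 2 ≤ 1 := pow_le_one₀ k0.le k1
  have key : (t + 2 * a) * η < r * t * η⁻¹ := by
    rw [← div_eq_mul_inv, lt_div_iff₀ hη]; nlinarith
  constructor
  · have : (branchInv r t a (1 + η * Complex.I)).im
        = r * t * η⁻¹ - t * k * η - 2 * (a * k ^ 2) * η := by
      rw [e]; simp [pow_two]; ring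
    rw [this]
    have : t * k * η ≤ t * 1 * η := by gcongr
    have : 2 * (a * k ^ 2) * η ≤ 2 * (a * 1) * η := by gcongr
    linarith
  · have : (branchInv r t a (1 + η * Complex.I) * (1 + η * Complex.I)).im
        = r * t * η⁻¹ - a * k * η := by
      rw [e]; simp [pow_two]
      linear_combination -(a * k * η) * k3
    rw [this]
    have : a * k * η ≤ a * 1 * η := by gcongr
    nlinarith [mul_pos ht hη, mul_nonneg ha hη.le]

/-- The set of `z` that carry a physical solution is open in the half-plane by the inverse function
theorem, relatively closed by compactness, and nonempty; the half-plane is connected. -/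
lemma exists_isBranch (hr0 : 0 < r) (hr1 : r ≤ 1) (ht : 0 < t) (ha : 0 ≤ a) {z : ℂ}
    (hz : 0 < z.im) : ∃ w, IsBranch r t a z w := by
  set U : Set ℂ := {z | 0 < z.im ∧ ∃ w, IsBranch r t a z w} with hU
  suffices h : {z : ℂ | 0 < z.im} ⊆ U from (h hz).2
  have hconv : Convex ℝ {z : ℂ | 0 < z.im} := convex_halfSpace_im_gt 0
  refine hconv.isPreconnected.subset_of_closure_inter_subset ?_ ?_ ?_
  · rw [isOpen_iff_mem_nhds]
    rintro z ⟨hz, w, hw⟩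
    have n1 := ne_zero_of_im_pos hw.im_pos
    obtain ⟨n2, hzw⟩ := (eq_iff_branchInv hr0 ht n1).1 hw.eq
    have hs := hasStrictDerivAt_branchInv (r := r) (t := t) (a := a) n1 n2
    have hmap := hs.map_nhds_eq (hw.deriv_ne_zero hr0 hr1 ht ha hz)
    have hc : ContinuousAt (branchInv r t a) w := hs.hasDerivAt.continuousAt
    rw [← hzw, ← hmap, mem_map]
    have c1 : ∀ᶠ v : ℂ in 𝓝 w, 0 < v.im :=
      Complex.continuous_im.continuousAt.eventually_const_lt hw.im_pos
    have c2 : ∀ᶠ v in 𝓝 w, 0 < (branchInv r t a v).im :=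
      (Complex.continuous_im.continuousAt.comp hc).eventually_const_lt (by
        simpa [hzw] using hz)
    have c3 : ∀ᶠ v in 𝓝 w, 0 < (branchInv r t a v * v).im :=
      (Complex.continuous_im.continuousAt.comp (hc.mul continuousAt_id)).eventually_const_lt (by
        simpa only [Function.comp, id, hzw, Pi.mul_apply] using! hw.mul_im_pos)
    have c4 : ∀ᶠ v : ℂ in 𝓝 w, 1 - v ≠ 0 :=
      (continuousAt_const.sub continuousAt_id).eventually_ne n2
    filter_upwards [c1, c2, c3, c4] with v h1 h2 h3 h4
    exact ⟨h2, v, h1, h3, (eq_iff_branchInv hr0 ht (ne_zero_of_im_pos h1)).2 ⟨h4, rfl⟩⟩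
  · obtain ⟨η, hη, hη1⟩ : ∃ η : ℝ, 0 < η ∧ (t + 2 * a) * η ^ 2 < r * t := by
      have hrt : 0 < r * t := by positivity
      have : 0 < r * t / (t + 2 * a + 1) := by positivity
      refine ⟨√(r * t / (t + 2 * a + 1)), by positivity, ?_⟩
      rw [Real.sq_sqrt this.le, mul_div_assoc', div_lt_iff₀ (by positivity)]
      nlinarith
    obtain ⟨h1, h2⟩ := isBranch_branchInv_of_small ht ha hη hη1
    have hi : 0 < (1 + η * Complex.I : ℂ).im := by simpa using hη
    refine ⟨_, h1, h1, 1 + η * Complex.I, hi, h2, ?_⟩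
    refine (eq_iff_branchInv hr0 ht (ne_zero_of_im_pos hi)).2 ⟨?_, rfl⟩
    intro h0
    have := congrArg Complex.im h0
    simp at this; exact hη.ne' this
  · rintro ζ ⟨hcl, hζ⟩
    obtain ⟨z, hzU, hzζ⟩ := mem_closure_iff_seq_limit.1 hcl
    choose hzi w hw using hzU
    obtain ⟨ω, φ, hφ, hω⟩ := IsBranch.exists_subseq hr0 hr1 ht ha (ne_zero_of_im_pos hζ) hzζ hzi hw
    exact ⟨hζ, ω, IsBranch.limit_isBranch hr0 hr1 ht (hzζ.comp hφ.tendsto_atTop) hω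
      (fun i => hzi _) (fun i => hw _) hζ⟩

open Classical in
/-- The physical branch on the upper half-plane. -/
noncomputable def branch (r t a : ℝ) (z : ℂ) : ℂ :=
  if h : ∃ w, IsBranch r t a z w then h.choose else 0

lemma isBranch_branch (hr0 : 0 < r) (hr1 : r ≤ 1) (ht : 0 < t) (ha : 0 ≤ a) {z : ℂ}
    (hz : 0 < z.im) : IsBranch r t a z (branch r t a z) := by
  have h := exists_isBranch hr0 hr1 ht ha hz
  rw [branch, dif_pos h]
  exact h.choose_spec

/-- Branch values are bounded near `ζ ≠ 0`, so it suffices to compute `g` at every subsequential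
limit. Taking `g = Complex.im` on the real axis avoids identifying the limit of the branch itself.
-/
lemma tendsto_comp_branch (hr0 : 0 < r) (hr1 : r ≤ 1) (ht : 0 < t) (ha : 0 ≤ a)
    {E : Type*} [TopologicalSpace E] {g : ℂ → E} (hg : Continuous g) {L : E}
    {ζ : ℂ} (hζ : ζ ≠ 0) {ι : Type*} {l : Filter ι} [l.IsCountablyGenerated] {u : ι → ℂ}
    (hu : Tendsto u l (𝓝 ζ)) (him : ∀ᶠ i in l, 0 < (u i).im)
    (H : ∀ (z : ℕ → ℂ) (ω : ℂ), (∀ i, 0 < (z i).im) → Tendsto z atTop (𝓝 ζ) →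
      Tendsto (fun i => branch r t a (z i)) atTop (𝓝 ω) → g ω = L) :
    Tendsto (fun i => g (branch r t a (u i))) l (𝓝 L) := by
  refine tendsto_of_subseq_tendsto fun ns hns => ?_
  obtain ⟨N, hN⟩ := eventually_atTop.1 (hns.eventually him)
  have hpos : ∀ i, 0 < (u (ns (i + N))).im := fun i => hN _ (by omega)
  have hlim : Tendsto (fun i => u (ns (i + N))) atTop (𝓝 ζ) :=
    (hu.comp hns).comp (tendsto_add_atTop_nat N)
  obtain ⟨ω, φ, hφ, hω⟩ := IsBranch.exists_subseq hr0 hr1 ht ha hζ hlim hpos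
    fun i => isBranch_branch hr0 hr1 ht ha (hpos i)
  refine ⟨fun i => φ i + N, ?_⟩
  rw [← H (fun i => u (ns (φ i + N))) ω (fun i => hpos _) (hlim.comp hφ.tendsto_atTop) hω]
  exact (hg.tendsto _).comp hω

lemma continuousAt_branch (hr0 : 0 < r) (hr1 : r ≤ 1) (ht : 0 < t) (ha : 0 ≤ a) {ζ : ℂ}
    (hζ : 0 < ζ.im) : ContinuousAt (branch r t a) ζ := by
  refine tendsto_comp_branch hr0 hr1 ht ha (g := id) continuous_id (ne_zero_of_im_pos hζ)
    tendsto_id (Complex.continuous_im.continuousAt.eventually_const_lt hζ) fun z ω hz hzζ hω => ?_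
  exact (IsBranch.limit_isBranch hr0 hr1 ht hzζ hω hz
    (fun i => isBranch_branch hr0 hr1 ht ha (hz i)) hζ).unique hr0 hr1 ht ha hζ
    (isBranch_branch hr0 hr1 ht ha hζ)

/-- The branch is a continuous right inverse of `branchInv`, whose derivative does not vanish at its
values. -/
lemma differentiableAt_branch (hr0 : 0 < r) (hr1 : r ≤ 1) (ht : 0 < t) (ha : 0 ≤ a) {ζ : ℂ}
    (hζ : 0 < ζ.im) : DifferentiableAt ℂ (branch r t a) ζ := by
  have hb := isBranch_branch hr0 hr1 ht ha hζ
  have n1 := ne_zero_of_im_pos hb.im_pos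
  obtain ⟨n2, -⟩ := (eq_iff_branchInv hr0 ht n1).1 hb.eq
  refine (HasDerivAt.of_local_left_inverse (continuousAt_branch hr0 hr1 ht ha hζ)
    (hasStrictDerivAt_branchInv n1 n2).hasDerivAt (hb.deriv_ne_zero hr0 hr1 ht ha hζ)
    ?_).differentiableAt
  filter_upwards [Complex.continuous_im.continuousAt.eventually_const_lt hζ] with z hz
  have hb := isBranch_branch hr0 hr1 ht ha hz
  exact ((eq_iff_branchInv hr0 ht (ne_zero_of_im_pos hb.im_pos)).1 hb.eq).2

end Branch

/-! ### The cubic at real `x`, Cardano's formula and the closed form -/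

section RealAlgebra
variable {r t a : ℝ}

lemma mpS_eq (x r t a : ℝ) : mpS x r t a = 4 * a * x ^ 3
    - (8 * a ^ 2 + 4 * a * (3 * r + 2) * t - t ^ 2) * x ^ 2
    + 2 * (2 * a ^ 3 - 2 * a ^ 2 * (5 * r - 2) * t
        + a * (r * (6 * r - 1) + 1) * t ^ 2 - (r + 1) * t ^ 3) * x
    + (r - 1) ^ 2 * t ^ 2 * (a ^ 2 - a * (4 * r - 2) * t + t ^ 2) := by
  simp only [mpS, mpCubic, Polynomial.eval_add, Polynomial.eval_sub, Polynomial.eval_mul,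
    Polynomial.eval_C, Polynomial.eval_pow, Polynomial.eval_X]

/-- The cubic `x w ^ 3 - (x + (1 - r) t) w ^ 2 + (t - a) w + a` factors as
`x (w - w₁) (w ^ 2 - s w + p)`. -/
structure CubicFactor (r t a x w₁ s p : ℝ) : Prop where
  sum : x * (w₁ + s) = x + (1 - r) * t
  mid : x * (p + w₁ * s) = t - a
  prod : x * w₁ * p = -a

/-- The right side is the discriminant of the cubic, `x ^ 4` times the product of squared root
differences, so `S` is that discriminant. -/
lemma CubicFactor.mpS_eq {x w₁ s p : ℝ} (h : CubicFactor r t a x w₁ s p) :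
    mpS x r t a = x ^ 4 * (s ^ 2 - 4 * p) * (w₁ ^ 2 - s * w₁ + p) ^ 2 := by
  obtain ⟨h1, h2, h3⟩ := h
  have e : mpS x r t a = 4 * a * x ^ 3
    - (8 * a ^ 2 + 12 * a * (r * t) + 8 * a * t - t ^ 2) * x ^ 2
    + 2 * (2 * a ^ 3 - 10 * a ^ 2 * (r * t) + 4 * a ^ 2 * t
        + a * (6 * (r * t) ^ 2 - (r * t) * t + t ^ 2) - (r * t) * t ^ 2 - t ^ 3) * x
    + (r * t - t) ^ 2 * (a ^ 2 - 4 * a * (r * t) + 2 * a * t + t ^ 2) := by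
    rw [_root_.mpS_eq]; ring
  -- Vieta's relations express `r t`, `t` and `a` through `x, w₁, s, p`, which turns the claim into
  -- a polynomial identity.
  have hR : r * t = x + t - x * (w₁ + s) := by linear_combination h1
  have ht : t = x * (p + w₁ * s) + a := by linear_combination -h2
  have ha : a = -(x * w₁ * p) := by linear_combination h3
  rw [e, hR, ht, ha]
  ring

/-- The coefficients are real, so `ω` comes with its conjugate; hence `s = 2 Re ω` and `p = |ω|²`.
-/
lemma cubicFactor_of_root {x ω : ℂ} {y : ℝ} (hy : 0 < y) (hx : x = (y : ℂ))
    (hω : ω.im ≠ 0) (h : (1 - ω) * (x * ω - (1 - r) * t - a / ω) = r * t) :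
    CubicFactor r t a y ((y + (1 - r) * t) / y - 2 * ω.re) (2 * ω.re) (ω.re ^ 2 + ω.im ^ 2) := by
  have h0 : ω ≠ 0 := by rintro rfl; simp at hω
  have hP : (y : ℂ) * ω ^ 3 - ((y + (1 - r) * t : ℝ) : ℂ) * ω ^ 2 + ((t - a : ℝ) : ℂ) * ω + a = 0 := by
    subst hx
    field_simp at h
    push_cast
    linear_combination -h
  obtain ⟨u, v⟩ := ω
  simp only at hω ⊢
  have e1 := congrArg Complex.im hP
  have e2 := congrArg Complex.re hP
  simp only [pow_succ, pow_zero, one_mul, Complex.add_im, Complex.sub_im, Complex.mul_im,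
    Complex.mul_re, Complex.ofReal_re, Complex.ofReal_im, Complex.add_re, Complex.sub_re,
    Complex.zero_re, Complex.zero_im] at e1 e2
  set c := y + (1 - r) * t with hc
  have f1 : y * (3 * u ^ 2 - v ^ 2) - 2 * c * u + (t - a) = 0 := by
    have : v * (y * (3 * u ^ 2 - v ^ 2) - 2 * c * u + (t - a)) = 0 := by linear_combination e1
    exact (mul_eq_zero.1 this).resolve_left hω
  have hyc : y * (c / y) = c := by field_simp
  refine ⟨?_, ?_, ?_⟩
  · linear_combination hyc
  · linear_combination 2 * u * hyc - f1
  · linear_combination (u ^ 2 + v ^ 2) * hyc + e2 - u * f1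

lemma mpS_neg_of_root {x ω : ℂ} {y : ℝ} (hy : 0 < y) (hx : x = (y : ℂ))
    (hω : ω.im ≠ 0) (h : (1 - ω) * (x * ω - (1 - r) * t - a / ω) = r * t) :
    mpS y r t a < 0 := by
  rw [(cubicFactor_of_root hy hx hω h).mpS_eq]
  set w₁ := (y + (1 - r) * t) / y - 2 * ω.re
  have hv : 0 < ω.im ^ 2 := by positivity
  have : 0 < w₁ ^ 2 - 2 * ω.re * w₁ + (ω.re ^ 2 + ω.im ^ 2) := by
    nlinarith [sq_nonneg (w₁ - ω.re)]
  have e : y ^ 4 * ((2 * ω.re) ^ 2 - 4 * (ω.re ^ 2 + ω.im ^ 2))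
      * (w₁ ^ 2 - 2 * ω.re * w₁ + (ω.re ^ 2 + ω.im ^ 2)) ^ 2
      = -(4 * (y ^ 4 * ω.im ^ 2 * (w₁ ^ 2 - 2 * ω.re * w₁ + (ω.re ^ 2 + ω.im ^ 2)) ^ 2)) := by ring
  rw [e]
  have : 0 < y ^ 4 * ω.im ^ 2 * (w₁ ^ 2 - 2 * ω.re * w₁ + (ω.re ^ 2 + ω.im ^ 2)) ^ 2 := by
    positivity
  linarith

/-- The cubic equals `a ≥ 0` at `0` and is nonpositive far to the left, so it has a root `w₁ ≤ 0`.
The root sum is positive, hence `s > 0`, and `S < 0` makes the remaining quadratic irreducible. -/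
lemma exists_cubicFactor (hr1 : r ≤ 1) (ht : 0 < t) (ha : 0 ≤ a) {x : ℝ} (hx : 0 < x)
    (hS : mpS x r t a < 0) :
    ∃ w₁ s p, CubicFactor r t a x w₁ s p ∧ w₁ ≤ 0 ∧ 0 < s ∧ s ^ 2 < 4 * p := by
  obtain ⟨w₁, hw₁, hroot⟩ : ∃ w₁ ≤ 0,
      x * w₁ ^ 3 - (x + (1 - r) * t) * w₁ ^ 2 + (t - a) * w₁ + a = 0 := by
    -- With `x M = x + 2 a` and `M ≥ 1`, the term `2 a M²` absorbs `a M + a` at `w = -M`.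
    set M := 1 + 2 * a / x
    have hM : 1 ≤ M := by have : 0 ≤ 2 * a / x := by positivity
                          linarith
    have hxM : x * M = x + 2 * a := by simp only [M]; field_simp
    have hcont : ContinuousOn
        (fun w : ℝ => x * w ^ 3 - (x + (1 - r) * t) * w ^ 2 + (t - a) * w + a)
        (Set.Icc (-M) 0) := by fun_prop
    have hc : 0 ≤ x + (1 - r) * t := by
      have : 0 ≤ 1 - r := by linarith
      positivity
    have hlow : x * (-M) ^ 3 - (x + (1 - r) * t) * (-M) ^ 2 + (t - a) * (-M) + a ≤ 0 := by
      have e : x * (-M) ^ 3 = -(x + 2 * a) * M ^ 2 := by rw [← hxM]; ring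
      rw [e]
      have h1 : 0 ≤ (x + (1 - r) * t) * M ^ 2 := by positivity
      have h2 : 0 ≤ t * M := by positivity
      have h3 : a * M ≤ a * M ^ 2 := by
        gcongr; nlinarith
      have h4 : a * 1 ≤ a * M ^ 2 := by
        gcongr; nlinarith
      have h5 : 0 ≤ x * M ^ 2 := by positivity
      nlinarith
    obtain ⟨w, hw, hw'⟩ := intermediate_value_Icc (by linarith : -M ≤ 0) hcont
      (show (0 : ℝ) ∈ Set.Icc _ _ from ⟨hlow, by simpa using ha⟩)
    exact ⟨w, hw.2, hw'⟩
  have hf : CubicFactor r t a x w₁ ((x + (1 - r) * t) / x - w₁)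
      ((t - a) / x - w₁ * ((x + (1 - r) * t) / x - w₁)) := by
    refine ⟨by field_simp; ring, by field_simp; ring, ?_⟩
    field_simp
    linear_combination hroot
  refine ⟨w₁, _, _, hf, hw₁, ?_, ?_⟩
  · have : 0 < (x + (1 - r) * t) / x := by
      have : 0 ≤ 1 - r := by linarith
      positivity
    linarith
  · rw [hf.mpS_eq] at hS
    by_contra hcon
    have : 0 ≤ x ^ 4 * ((((x + (1 - r) * t) / x - w₁)) ^ 2
      - 4 * ((t - a) / x - w₁ * ((x + (1 - r) * t) / x - w₁))) := by
      have := not_lt.1 hcon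
      have : 0 ≤ x ^ 4 := by positivity
      apply mul_nonneg this; linarith
    have := mul_nonneg this (sq_nonneg (w₁ ^ 2 - ((x + (1 - r) * t) / x - w₁) * w₁
      + ((t - a) / x - w₁ * ((x + (1 - r) * t) / x - w₁))))
    linarith

variable {x w₁ s p : ℝ}

/-- Vieta's identities for the rational part of `g` and for the linear coefficient of the depressed
resolvent cubic. -/
lemma CubicFactor.rational_part (h : CubicFactor r t a x w₁ s p) :
    -2 * x ^ 3 + 3 * ((2 * r + 1) * t + 6 * a) * x ^ 2
      - 3 * ((r - 1) * ((2 * r + 1) * t - 3 * a) * t) * x + 2 * (r - 1) ^ 3 * t ^ 3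
      = 9 * x ^ 3 * (s - 2 * w₁) * ((2 * w₁ - s) ^ 2 / 36 + p - s ^ 2 / 4) := by
  obtain ⟨h1, h2, h3⟩ := h
  have e : -2 * x ^ 3 + 3 * ((2 * r + 1) * t + 6 * a) * x ^ 2
      - 3 * ((r - 1) * ((2 * r + 1) * t - 3 * a) * t) * x + 2 * (r - 1) ^ 3 * t ^ 3
      = -2 * x ^ 3 + 3 * (2 * (r * t) + t + 6 * a) * x ^ 2
      - 3 * ((r * t - t) * (2 * (r * t) + t - 3 * a)) * x + 2 * (r * t - t) ^ 3 := by ring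
  have hR : r * t = x + t - x * (w₁ + s) := by linear_combination h1
  have ht : t = x * (p + w₁ * s) + a := by linear_combination -h2
  have ha : a = -(x * w₁ * p) := by linear_combination h3
  rw [e, hR, ht, ha]
  ring

lemma CubicFactor.linear_part (h : CubicFactor r t a x w₁ s p) :
    x ^ 2 + (3 * a - (2 * r + 1) * t) * x + t ^ 2 * (r - 1) ^ 2
      = x ^ 2 * (w₁ ^ 2 - w₁ * s + s ^ 2 - 3 * p) := by
  obtain ⟨h1, h2, h3⟩ := h
  have e : x ^ 2 + (3 * a - (2 * r + 1) * t) * x + t ^ 2 * (r - 1) ^ 2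
      = x ^ 2 + (3 * a - (2 * (r * t) + t)) * x + (r * t - t) ^ 2 := by ring
  have hR : r * t = x + t - x * (w₁ + s) := by linear_combination h1
  have ht : t = x * (p + w₁ * s) + a := by linear_combination -h2
  have ha : a = -(x * w₁ * p) := by linear_combination h3
  rw [e, hR, ht, ha]
  ring

lemma CubicFactor.mpG_eq (h : CubicFactor r t a x w₁ s p) :
    mpG x r t a = 9 * x ^ 3 * (s - 2 * w₁) * ((2 * w₁ - s) ^ 2 / 36 + p - s ^ 2 / 4)
      + 3 * x * √(-3 * mpS x r t a) := by
  rw [mpG, ← h.rational_part]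
  ring

lemma CubicFactor.mpG_pos (h : CubicFactor r t a x w₁ s p) (hx : 0 < x) (hw₁ : w₁ ≤ 0)
    (hs : 0 < s) (hp : s ^ 2 < 4 * p) : 0 < mpG x r t a := by
  rw [h.mpG_eq]
  have h1 : 0 < s - 2 * w₁ := by linarith
  have h2 : 0 < (2 * w₁ - s) ^ 2 / 36 + p - s ^ 2 / 4 := by
    have := sq_nonneg (2 * w₁ - s)
    linarith
  positivity

/-- `φ` is Cardano's expression for a root of the resolvent cubic whose roots are `-x` times the
pairwise sums of the roots of the original cubic. Only the conjugate pair has a real sum, `s`, and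
`φ` is real, so `φ = -x s`. -/
lemma CubicFactor.mpPhi_eq (h : CubicFactor r t a x w₁ s p) (hx : 0 < x) (hw₁ : w₁ ≤ 0)
    (hs : 0 < s) (hp : s ^ 2 < 4 * p) : mpPhi x r t a = -(x * s) := by
  have hg := h.mpG_pos hx hw₁ hs hp
  have hS : mpS x r t a ≤ 0 := by
    rw [h.mpS_eq]
    have : 0 ≤ x ^ 4 * (4 * p - s ^ 2) * (w₁ ^ 2 - s * w₁ + p) ^ 2 := by
      have : 0 ≤ 4 * p - s ^ 2 := by linarith
      positivity
    linarith
  have hD := Real.sq_sqrt (show 0 ≤ -3 * mpS x r t a by linarith)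
  have hgeq := h.mpG_eq
  have hSeq := h.mpS_eq
  set D := √(-3 * mpS x r t a)
  rw [mpPhi, h.linear_part]
  set g := mpG x r t a
  obtain ⟨hh0, hh⟩ : 0 < g ^ (1 / 3 : ℝ) ∧ (g ^ (1 / 3 : ℝ)) ^ 3 = g := by
    refine ⟨by positivity, ?_⟩
    rw [← Real.rpow_natCast, ← Real.rpow_mul hg.le]; norm_num
  obtain ⟨hk0, hk⟩ : 0 < (2 : ℝ) ^ (1 / 3 : ℝ) ∧ ((2 : ℝ) ^ (1 / 3 : ℝ)) ^ 3 = 2 := by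
    refine ⟨by positivity, ?_⟩
    rw [← Real.rpow_natCast, ← Real.rpow_mul (by norm_num)]; norm_num
  set k := (2 : ℝ) ^ (1 / 3 : ℝ)
  set y := g ^ (1 / 3 : ℝ)
  set G₀ := 9 * x ^ 3 * (s - 2 * w₁) * ((2 * w₁ - s) ^ 2 / 36 + p - s ^ 2 / 4) with hG₀
  set K := x ^ 2 * (w₁ ^ 2 - w₁ * s + s ^ 2 - 3 * p) with hK
  -- `g` and its conjugate, with the opposite sign of the square root, have sum `2 G₀` and product
  -- `4 K ^ 3`.
  have hquad : g ^ 2 - 2 * G₀ * g + 4 * K ^ 3 = 0 := by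
    have : G₀ ^ 2 - 9 * x ^ 2 * (-3 * mpS x r t a) = 4 * K ^ 3 := by
      rw [hSeq, hG₀, hK]; ring
    rw [hgeq, ← this, ← hD]; ring
  obtain ⟨u, hu⟩ : ∃ u, u = y / (3 * k) := ⟨_, rfl⟩
  obtain ⟨v, hv⟩ : ∃ v, v = k / 3 * (K / y) := ⟨_, rfl⟩
  have huv : u * v = K / 9 := by rw [hu, hv]; field_simp; ring
  have hu3 : u ^ 3 = g / 54 := by
    rw [hu, div_pow, mul_pow, hh, hk]; norm_num
  have hv3 : v ^ 3 = 2 * K ^ 3 / (27 * g) := by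
    rw [hv, mul_pow, div_pow, div_pow, hh, hk]; field_simp; ring
  have hsum : u ^ 3 + v ^ 3 = G₀ / 27 := by
    rw [hu3, hv3]; field_simp; linear_combination 27 * hquad
  -- The depressed resolvent `Y ^ 3 - (K / 3) Y + G₀ / 27`, already factored, at `Y = -(u + v)`. The
  -- quadratic factor has no real zero.
  have hy1 : (-(u + v) - x * (2 * w₁ - s) / 3) * ((-(u + v) + x * (2 * w₁ - s) / 6) ^ 2
      + x ^ 2 * (p - s ^ 2 / 4)) = 0 := by
    have : (-(u + v)) ^ 3 = -(G₀ / 27) - K / 3 * (u + v) := by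
      rw [← hsum]; linear_combination -3 * (u + v) * huv
    linear_combination this - hG₀ / 27 + (-(u + v)) * hK / 3
  have hpos : 0 < (-(u + v) + x * (2 * w₁ - s) / 6) ^ 2 + x ^ 2 * (p - s ^ 2 / 4) := by
    have : 0 < p - s ^ 2 / 4 := by linarith
    positivity
  have hy2 := (mul_eq_zero.1 hy1).resolve_right hpos.ne'
  have : -(2 / 3) * (x - (r - 1) * t) = -(2 / 3) * (x * (w₁ + s)) := by rw [h.sum]; ring
  rw [this, ← hv, ← hu]
  linarith

/-- The principal roots of conjugate numbers are conjugate, so the sum is twice the real part. This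
fails on the negative axis, where both are the same imaginary number; the hypothesis on `δ = 0`
excludes that case. -/
lemma sqrt_add_sqrt_conj {b δ : ℝ} (hδ : 0 ≤ δ) (h : δ = 0 → 0 < b) :
    Complex.sqrt (b - δ * Complex.I) + Complex.sqrt (b + δ * Complex.I)
      = ((2 * √((√(b ^ 2 + δ ^ 2) + b) / 2) : ℝ) : ℂ) := by
  have e : (b - δ * Complex.I : ℂ) = b + ((-δ : ℝ) : ℂ) * Complex.I := by push_cast; ring
  rw [Complex.sqrt_eq_real_add_ite, Complex.sqrt_eq_real_add_ite, e, Complex.norm_add_mul_I,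
    Complex.norm_add_mul_I]
  simp only [neg_sq, Complex.add_re, Complex.add_im, Complex.ofReal_re, Complex.ofReal_im,
    Complex.mul_re, Complex.mul_im, Complex.I_re, Complex.I_im, mul_zero, mul_one, zero_add,
    sub_zero, add_zero]
  rcases hδ.eq_or_lt with rfl | hδ'
  · have hb := h rfl
    simp [Real.sqrt_sq hb.le]; ring
  · rw [if_neg (by linarith), if_pos hδ]
    push_cast; ring

/-- Since `φ = -x s`, the numbers `d₋, d₊` are conjugate with modulus `2 x p - (t - a)`. Their roots
average to `√(x p)`, and `d₀ = x (1 - s + p)`. For a root `ω` of the quadratic factor these are `√x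
|ω|` and `x |1 - ω|²`. -/
lemma CubicFactor.complex_part (h : CubicFactor r t a x w₁ s p) (ht : 0 < t) (ha : 0 ≤ a)
    (hx : 0 < x) (hw₁ : w₁ ≤ 0) (hs : 0 < s) (hp : s ^ 2 < 4 * p) :
    mpFL x r t a = (((√(x * p) - √(x * (1 - s + p))) ^ 2 : ℝ) : ℂ) ∧
    mpFR x r t a = (((√(x * p) + √(x * (1 - s + p))) ^ 2 : ℝ) : ℂ) := by
  have hphi := h.mpPhi_eq hx hw₁ hs hp
  have hmid := h.mid
  have hprod := h.prod
  have hδ0 : 0 ≤ a * (x * s) := by positivity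
  set δ := 2 * √(a * (x * s)) with hδ
  have hδ2 : δ ^ 2 = 4 * (a * (x * s)) := by rw [hδ, mul_pow, Real.sq_sqrt hδ0]; ring
  have hsq : 2 * Complex.sqrt ((a : ℂ) * (mpPhi x r t a : ℂ)) = δ * Complex.I := by
    have e : ((a : ℂ) * (mpPhi x r t a : ℂ)) = -((a * (x * s) : ℝ) : ℂ) := by
      rw [hphi]; push_cast; ring
    rw [e, Complex.sqrt_neg_of_nonneg (by exact_mod_cast hδ0), Complex.sqrt_of_nonneg
      (by exact_mod_cast hδ0), Complex.ofReal_re, hδ]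
    push_cast; ring
  have hm : mpDMinus x r t a = ((t - a : ℝ) : ℂ) - δ * Complex.I := by
    rw [mpDMinus, hsq]; push_cast; ring
  have hpl : mpDPlus x r t a = ((t - a : ℝ) : ℂ) + δ * Complex.I := by
    rw [mpDPlus, hsq]; push_cast; ring
  have hroot : √((t - a) ^ 2 + δ ^ 2) = 2 * (x * p) - (t - a) := by
    rw [Real.sqrt_eq_iff_mul_self_eq (by positivity)]
    · rw [hδ2]
      linear_combination (4 * x * s) * hprod - 4 * x * p * hmid
    · have : 0 < x * p := by
        have : 0 < p := by nlinarith [sq_nonneg s]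
        positivity
      have : 0 ≤ x * (-w₁) * s := by
        have : 0 ≤ -w₁ := by linarith
        positivity
      nlinarith
  have hsum : (Complex.sqrt (mpDMinus x r t a) + Complex.sqrt (mpDPlus x r t a)) / 2
      = ((√(x * p) : ℝ) : ℂ) := by
    rw [hm, hpl, sqrt_add_sqrt_conj (by positivity), hroot]
    · push_cast; ring_nf
    · intro h0
      have : a * (x * s) = 0 := by nlinarith
      have : a = 0 := by
        rcases mul_eq_zero.1 this with h | h
        · exact h
        · exact absurd h (by positivity)
      rw [this]; linarith
  have hd0 : mpDZero x r t a = ((x * (1 - s + p) : ℝ) : ℂ) := by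
    have e : mpDMinus x r t a * mpDPlus x r t a = (((t - a) ^ 2 + δ ^ 2 : ℝ) : ℂ) := by
      rw [hm, hpl]; push_cast; linear_combination -(δ : ℂ) ^ 2 * Complex.I_sq
    rw [mpDZero, e, Complex.sqrt_of_nonneg (by exact_mod_cast (by positivity)), Complex.ofReal_re,
      hroot, hphi]
    push_cast; ring
  have hd0' : Complex.sqrt (mpDZero x r t a) = ((√(x * (1 - s + p)) : ℝ) : ℂ) := by
    rw [hd0, Complex.sqrt_of_nonneg, Complex.ofReal_re]
    have : 0 ≤ x * (1 - s + p) := by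
      apply mul_nonneg hx.le; nlinarith [sq_nonneg (s - 2)]
    exact_mod_cast this
  constructor
  · rw [mpFL, hsum, hd0']; push_cast; ring
  · rw [mpFR, hsum, hd0']; push_cast; ring

/-- Heron's formula for the triangle `0, 1, ω`, scaled by `x`: the product is `16 x²` times the
squared area. Its positivity, together with `f_L ≤ f_R`, places `x` strictly between them. -/
lemma CubicFactor.density_part (h : CubicFactor r t a x w₁ s p) (ht : 0 < t) (ha : 0 ≤ a)
    (hx : 0 < x) (hw₁ : w₁ ≤ 0) (hs : 0 < s) (hp : s ^ 2 < 4 * p) :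
    (mpFL x r t a).im = 0 ∧ (mpFR x r t a).im = 0 ∧
    (mpFL x r t a).re < x ∧ x < (mpFR x r t a).re ∧
    √((x - (mpFL x r t a).re) * ((mpFR x r t a).re - x)) = x * √(4 * p - s ^ 2) := by
  obtain ⟨hL, hR⟩ := h.complex_part ht ha hx hw₁ hs hp
  rw [hL, hR]
  simp only [Complex.ofReal_im, Complex.ofReal_re, true_and]
  have hp0 : 0 < p := by nlinarith [sq_nonneg s]
  have hA : 0 ≤ x * p := by positivity
  have hB : 0 ≤ x * (1 - s + p) := by
    apply mul_nonneg hx.le; nlinarith [sq_nonneg (s - 2)]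
  have a2 := Real.sq_sqrt hA
  have b2 := Real.sq_sqrt hB
  have a0 := Real.sqrt_nonneg (x * p)
  have b0 := Real.sqrt_nonneg (x * (1 - s + p))
  set A := √(x * p)
  set B := √(x * (1 - s + p))
  have key : (x - (A - B) ^ 2) * ((A + B) ^ 2 - x) = x ^ 2 * (4 * p - s ^ 2) := by
    have : (x - (A - B) ^ 2) * ((A + B) ^ 2 - x)
      = -x ^ 2 + 2 * x * (A ^ 2 + B ^ 2) - (A ^ 2 - B ^ 2) ^ 2 := by ring
    rw [this, a2, b2]; ring
  have hpos : 0 < (x - (A - B) ^ 2) * ((A + B) ^ 2 - x) := by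
    rw [key]
    have : 0 < 4 * p - s ^ 2 := by linarith
    positivity
  have hle : (A - B) ^ 2 ≤ (A + B) ^ 2 := by nlinarith [mul_nonneg a0 b0]
  refine ⟨?_, ?_, ?_⟩
  · by_contra hc
    have h1 : x - (A - B) ^ 2 ≤ 0 := by linarith
    have h2 : 0 ≤ (A + B) ^ 2 - x := by linarith
    linarith [mul_nonpos_of_nonpos_of_nonneg h1 h2]
  · by_contra hc
    have h1 : (A + B) ^ 2 - x ≤ 0 := by linarith
    have h2 : 0 ≤ x - (A - B) ^ 2 := by linarith
    linarith [mul_nonpos_of_nonneg_of_nonpos h2 h1]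
  · rw [key, Real.sqrt_mul (by positivity), Real.sqrt_sq hx.le]

end RealAlgebra

/-! ### The sign of `S` and the support endpoints -/

section Roots
variable {r t a : ℝ}

lemma exists_roots_of_quadratic_neg {A B C m : ℝ} (hA : 0 < A) (h : A * m ^ 2 + B * m + C < 0) :
    ∃ α γ, α < m ∧ m < γ ∧ B = -(A * (α + γ)) ∧ C = A * (α * γ) := by
  have hΔ : (2 * A * m + B) ^ 2 < B ^ 2 - 4 * A * C := by nlinarith
  have hΔ0 : 0 ≤ B ^ 2 - 4 * A * C := (sq_nonneg _).trans hΔ.le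
  have hq2 := Real.sq_sqrt hΔ0
  have hq := abs_lt_of_sq_lt_sq (hΔ.trans_eq hq2.symm) (Real.sqrt_nonneg _)
  set q := √(B ^ 2 - 4 * A * C)
  obtain ⟨h1, h2⟩ := abs_lt.1 hq
  refine ⟨(-B - q) / (2 * A), (-B + q) / (2 * A), ?_, ?_, ?_, ?_⟩
  · rw [div_lt_iff₀ (by positivity)]; linarith
  · rw [lt_div_iff₀ (by positivity)]; linarith
  · field_simp; ring
  · field_simp; linear_combination hq2

lemma mpS_zero_nonneg (hr1 : r ≤ 1) (ht : 0 < t) (ha : 0 ≤ a) :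
    0 ≤ mpS 0 r t a := by
  rw [mpS_eq]
  have : 0 ≤ a ^ 2 - a * (4 * r - 2) * t + t ^ 2 := by
    have : 0 ≤ a * t * (1 - r) := by
      have : 0 ≤ 1 - r := by linarith
      positivity
    nlinarith [sq_nonneg (a - t)]
  have : 0 ≤ (r - 1) ^ 2 * t ^ 2 * (a ^ 2 - a * (4 * r - 2) * t + t ^ 2) := by positivity
  linarith

/-- `S` is negative at the mean `t + a`. -/
lemma mpS_mean_neg (hr0 : 0 < r) (hr1 : r ≤ 1) (ht : 0 < t) (ha : 0 ≤ a) :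
    mpS (t + a) r t a < 0 := by
  have e : mpS (t + a) r t a = -(r * t * ((2 - r) * t * (t + a) ^ 2 + 12 * a * (1 - r) * t * (t + a)
      + 4 * a * (r - 1) ^ 2 * t ^ 2 + 12 * a ^ 2 * (t + a) + 20 * a ^ 2 * (t + a)
      + 2 * a * t * (t + a) + 2 * t ^ 2 * (t + a))) := by
    rw [mpS_eq]; ring
  rw [e]
  have h1 : 0 ≤ 1 - r := by linarith
  have h2 : 0 < 2 - r := by linarith
  have : 0 < r * t * ((2 - r) * t * (t + a) ^ 2 + 12 * a * (1 - r) * t * (t + a)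
      + 4 * a * (r - 1) ^ 2 * t ^ 2 + 12 * a ^ 2 * (t + a) + 20 * a ^ 2 * (t + a)
      + 2 * a * t * (t + a) + 2 * t ^ 2 * (t + a)) := by positivity
  linarith

lemma eval_mpCubic (x : ℝ) : (mpCubic r t a).eval x = mpS x r t a := rfl

/-- `S` is nonnegative at `0`, negative at `t + a`, and has positive leading coefficient. For `a >
0`, splitting off a root `β` in `[0, t + a)` leaves a quadratic negative at `t + a`, with roots `α <
t + a < γ`; then `x_L = max α β` and `x_R = γ`. -/
lemma exists_support (hr0 : 0 < r) (hr1 : r ≤ 1) (ht : 0 < t) (ha : 0 ≤ a) :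
    ∃ xL xR : ℝ, IsTwoLargestRoots (mpCubic r t a) xL xR ∧ 0 ≤ xL ∧ xL < xR ∧
      (∀ x ∈ Set.Ioo xL xR, mpS x r t a < 0) ∧
      (∀ x, 0 < x → x ∉ Set.Ioo xL xR → 0 ≤ mpS x r t a) := by
  have hm := mpS_mean_neg hr0 hr1 ht ha
  have h0 := mpS_zero_nonneg hr1 ht ha
  have hm0 : 0 < t + a := by positivity
  rcases ha.eq_or_lt with rfl | ha'
  · have hS : ∀ x, mpS x r t 0 = t ^ 2 * x ^ 2 + (-(2 * (r + 1) * t ^ 3)) * x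
        + (r - 1) ^ 2 * t ^ 4 := by
      intro x; rw [mpS_eq]; ring
    rw [hS] at hm h0
    obtain ⟨α, γ, h1, h2, hB, hC⟩ := exists_roots_of_quadratic_neg (by positivity) hm
    have hS' : ∀ x, mpS x r t 0 = t ^ 2 * ((x - α) * (x - γ)) := by
      intro x; rw [hS, hB, hC]; ring
    have hγ : 0 < γ := by linarith
    have hα : 0 ≤ α := by
      have : 0 ≤ t ^ 2 * γ * α := by rw [hC] at h0; linarith
      exact nonneg_of_mul_nonneg_right this (by positivity)
    have hp : mpCubic r t 0 = Polynomial.C (t ^ 2) *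
        ((Polynomial.X - Polynomial.C α) * (Polynomial.X - Polynomial.C γ)) := by
      refine Polynomial.funext fun x => ?_
      rw [eval_mpCubic, hS']; simp
    refine ⟨α, γ, ⟨by linarith, 0, ?_, by simp⟩, hα, by linarith, ?_, ?_⟩
    · rw [hp, Polynomial.roots_C_mul _ (by positivity), Polynomial.roots_mul (mul_ne_zero
        (Polynomial.X_sub_C_ne_zero _) (Polynomial.X_sub_C_ne_zero _)),
        Polynomial.roots_X_sub_C, Polynomial.roots_X_sub_C]
      rfl
    · rintro x ⟨hx1, hx2⟩
      rw [hS']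
      exact mul_neg_of_pos_of_neg (by positivity)
        (mul_neg_of_pos_of_neg (by linarith) (by linarith))
    · intro x hx hx'
      rw [hS']
      refine mul_nonneg (by positivity) ?_
      rcases le_or_gt x α with h | h
      · exact mul_nonneg_of_nonpos_of_nonpos (by linarith) (by linarith)
      · have : γ ≤ x := by
          by_contra hc; exact hx' ⟨h, not_le.1 hc⟩
        exact mul_nonneg (by linarith) (by linarith)
  · have hcont : ContinuousOn (fun x => mpS x r t a) (Set.Icc 0 (t + a)) := by
      simp only [mpS_eq]; fun_prop
    obtain ⟨β, ⟨hβ0, hβm⟩, hβ⟩ := intermediate_value_Icc' hm0.le hcont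
      (show (0 : ℝ) ∈ Set.Icc _ _ from ⟨hm.le, h0⟩)
    have hβm' : β < t + a := by
      refine lt_of_le_of_ne hβm ?_
      rintro rfl
      exact hm.ne hβ
    obtain ⟨B₂, B₁, B₀, hS⟩ : ∃ B₂ B₁ B₀ : ℝ, ∀ x, mpS x r t a
        = 4 * a * x ^ 3 + B₂ * x ^ 2 + B₁ * x + B₀ :=
      ⟨-(8 * a ^ 2 + 4 * a * (3 * r + 2) * t - t ^ 2), 2 * (2 * a ^ 3 - 2 * a ^ 2 * (5 * r - 2) * t
        + a * (r * (6 * r - 1) + 1) * t ^ 2 - (r + 1) * t ^ 3),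
        (r - 1) ^ 2 * t ^ 2 * (a ^ 2 - a * (4 * r - 2) * t + t ^ 2),
        fun x => by rw [mpS_eq]; ring⟩
    have hβ' : 4 * a * β ^ 3 + B₂ * β ^ 2 + B₁ * β + B₀ = 0 := by rw [← hS]; exact hβ
    have hQ : ∀ x, mpS x r t a = (x - β) * (4 * a * x ^ 2 + (B₂ + 4 * a * β) * x
        + (B₁ + B₂ * β + 4 * a * β ^ 2)) := by
      intro x; rw [hS]; linear_combination hβ'
    have hQm : 4 * a * (t + a) ^ 2 + (B₂ + 4 * a * β) * (t + a)
        + (B₁ + B₂ * β + 4 * a * β ^ 2) < 0 := by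
      rw [hQ] at hm
      exact neg_of_mul_neg_right hm (by linarith)
    obtain ⟨α, γ, h1, h2, hB, hC⟩ := exists_roots_of_quadratic_neg (by positivity) hQm
    have hS' : ∀ x, mpS x r t a = 4 * a * ((x - β) * (x - α) * (x - γ)) := by
      intro x; rw [hQ, hB, hC]; ring
    have hγ : 0 < γ := by linarith
    -- From `0 ≤ S(0) = -4 a α β γ` with `γ > 0`. Hence on `(0, max α β]` the factor `(x - α) (x -
    -- β)` is nonpositive.
    have hαβ : α * β ≤ 0 := by
      rw [hS'] at h0
      by_contra hc
      have : 0 < 4 * a * (α * β * γ) := by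
        have := not_le.1 hc
        positivity
      linarith
    have hp : mpCubic r t a = Polynomial.C (4 * a) * ((Polynomial.X - Polynomial.C β) *
        (Polynomial.X - Polynomial.C α) * (Polynomial.X - Polynomial.C γ)) := by
      refine Polynomial.funext fun x => ?_
      rw [eval_mpCubic, hS']; simp
    have hroots : (mpCubic r t a).roots = {β} + {α} + {γ} := by
      rw [hp, Polynomial.roots_C_mul _ (by positivity), Polynomial.roots_mul (mul_ne_zero
        (mul_ne_zero (Polynomial.X_sub_C_ne_zero _) (Polynomial.X_sub_C_ne_zero _))
          (Polynomial.X_sub_C_ne_zero _)), Polynomial.roots_mul (mul_ne_zero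
        (Polynomial.X_sub_C_ne_zero _) (Polynomial.X_sub_C_ne_zero _)),
        Polynomial.roots_X_sub_C, Polynomial.roots_X_sub_C, Polynomial.roots_X_sub_C]
    have hlt : max α β < γ := by rw [max_lt_iff]; constructor <;> linarith
    refine ⟨max α β, γ, ⟨hlt.le, {min α β}, ?_, ?_⟩, le_max_of_le_right hβ0, hlt, ?_, ?_⟩
    · rw [hroots]
      rcases le_total α β with h | h
      · rw [max_eq_right h, min_eq_left h]
        simp only [← Multiset.singleton_add]
        abel
      · rw [max_eq_left h, min_eq_right h]
        simp only [← Multiset.singleton_add]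
        abel
    · intro w hw
      rw [Multiset.mem_singleton.1 hw]
      exact min_le_max
    · rintro x ⟨hx1, hx2⟩
      rw [max_lt_iff] at hx1
      rw [hS']
      exact mul_neg_of_pos_of_neg (by positivity)
        (mul_neg_of_pos_of_neg (mul_pos (by linarith) (by linarith)) (by linarith))
    · intro x hx hx'
      rw [hS']
      refine mul_nonneg (by positivity) ?_
      rcases le_or_gt x (max α β) with h | h
      · refine mul_nonneg_of_nonpos_of_nonpos ?_ (by linarith)
        -- When `β = 0` the other root `α` may be positive and then serves as `x_L`; when `β > 0`,
        -- `α` is at most `0`.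
        rcases hβ0.eq_or_lt with hb | hb
        · rw [← hb] at h ⊢
          have : x ≤ α := by
            rcases le_max_iff.1 h with h | h
            · exact h
            · linarith
          exact mul_nonpos_of_nonneg_of_nonpos (by linarith) (by linarith)
        · have hα : α ≤ 0 := by
            by_contra hc
            have := mul_pos (not_le.1 hc) hb
            linarith
          have : x ≤ β := by
            rcases le_max_iff.1 h with h | h
            · linarith
            · exact h
          exact mul_nonpos_of_nonpos_of_nonneg (by linarith) (by linarith)
      · have : γ ≤ x := by
          by_contra hc; exact hx' ⟨h, not_le.1 hc⟩
        rw [max_lt_iff] at h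
        exact mul_nonneg (mul_nonneg (by linarith) (by linarith)) (by linarith)

end Roots

/-! ### Boundary values of the branch on the real axis -/

section Boundary
variable {r t a : ℝ}

/-- Evaluating the cubic at `1` gives `r t = x (1 - w₁) (1 - s + p)`. With `k = -w₁`, the right side
exceeds it by `x (1 + k) (k + s + p / k)`. So the real root violates the limiting bound. -/
lemma CubicFactor.lt_of_real_root {x w₁ s p : ℝ} (h : CubicFactor r t a x w₁ s p) (hx : 0 < x)
    (hw₁ : w₁ < 0) (hs : 0 < s) (hp : 0 < p) :
    r * t < ‖1 - (w₁ : ℂ)‖ ^ 2 * (‖(x : ℂ)‖ + a / ‖(w₁ : ℂ)‖ ^ 2) := by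
  have e1 : ‖1 - (w₁ : ℂ)‖ ^ 2 = (1 - w₁) ^ 2 := by
    rw [← Complex.ofReal_one, ← Complex.ofReal_sub, Complex.norm_real, Real.norm_eq_abs, sq_abs]
  have e2 : ‖(w₁ : ℂ)‖ ^ 2 = w₁ ^ 2 := by rw [Complex.norm_real, Real.norm_eq_abs, sq_abs]
  rw [e1, e2, Complex.norm_real, Real.norm_of_nonneg hx.le]
  obtain ⟨h1, h2, h3⟩ := h
  have hrt : r * t = x * (1 - w₁) * (1 - s + p) := by linear_combination h1 - h2 + h3
  have ha : a / w₁ ^ 2 = x * p * (-w₁)⁻¹ := by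
    have : w₁ ≠ 0 := hw₁.ne
    have h4 : a = -(x * w₁ * p) := by linear_combination h3
    rw [h4]
    field_simp
  rw [ha, hrt]
  obtain ⟨k, rfl⟩ : ∃ k, w₁ = -k := ⟨-w₁, by ring⟩
  have hk : 0 < k := by linarith
  have e : (1 - -k) ^ 2 * (x + x * p * (- -k)⁻¹)
      = x * (1 - -k) * (1 - s + p) + x * (1 + k) * (k + s + p * k⁻¹) := by
    rw [neg_neg]; field_simp; ring
  rw [e]
  have : 0 < x * (1 + k) * (k + s + p * k⁻¹) := by positivity
  linarith

lemma mpFormula_of_cubicFactor {xL xR x w₁ s p : ℝ} (hr0 : 0 < r) (ht : 0 < t) (ha : 0 ≤ a)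
    (hmem : x ∈ Set.Ioo xL xR) (h : CubicFactor r t a x w₁ s p)
    (hx : 0 < x) (hw₁ : w₁ ≤ 0) (hs : 0 < s) (hp : s ^ 2 < 4 * p) :
    Real.pi * r * t * mpFormula r t a xL xR x = √(4 * p - s ^ 2) / 2 := by
  rw [mpFormula, Set.indicator_of_mem hmem, (h.density_part ht ha hx hw₁ hs hp).2.2.2.2]
  have := Real.pi_pos
  field_simp

/-- For `x < 0`, the limits of `Im w ≥ 0` and `Im (z w) ≥ 0` force a real limit. For `x > 0` off the
support, a nonreal root would make `S` negative. On the support the bound excludes `w₁`, and what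
remains is the root of the quadratic with nonnegative imaginary part. -/
lemma tendsto_branch_im (hr0 : 0 < r) (hr1 : r ≤ 1) (ht : 0 < t) (ha : 0 ≤ a) {xL xR : ℝ}
    (hL : 0 ≤ xL) (hneg : ∀ x ∈ Set.Ioo xL xR, mpS x r t a < 0)
    (hpos : ∀ x, 0 < x → x ∉ Set.Ioo xL xR → 0 ≤ mpS x r t a) {x : ℝ} (hx : x ≠ 0) :
    Tendsto (fun ε : ℝ => (branch r t a (x + ε * Complex.I)).im) (𝓝[>] 0)
      (𝓝 (Real.pi * r * t * mpFormula r t a xL xR x)) := by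
  have hu : Tendsto (fun ε : ℝ => (x + ε * Complex.I : ℂ)) (𝓝[>] 0) (𝓝 (x : ℂ)) := by
    have : Continuous fun ε : ℝ => (x + ε * Complex.I : ℂ) := by fun_prop
    have := this.tendsto 0
    simp only [Complex.ofReal_zero, zero_mul, add_zero] at this
    exact this.mono_left nhdsWithin_le_nhds
  refine tendsto_comp_branch hr0 hr1 ht ha (g := Complex.im) Complex.continuous_im
    (by exact_mod_cast hx) hu ?_ ?_
  · filter_upwards [self_mem_nhdsWithin] with ε hε
    simpa using hε
  · intro z ω hz hzx hω
    obtain ⟨h0, he, hi, hmi, hb⟩ := IsBranch.limit hr0 hr1 ht hzx hω hz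
      fun i => isBranch_branch hr0 hr1 ht ha (hz i)
    rw [Complex.im_ofReal_mul] at hmi
    rcases lt_or_gt_of_ne hx with hx0 | hx0
    · have : x ∉ Set.Ioo xL xR := fun h => by linarith [h.1]
      rw [mpFormula, Set.indicator_of_notMem this, mul_zero]
      nlinarith
    · by_cases hmem : x ∈ Set.Ioo xL xR
      · obtain ⟨w₁, s, p, hf, hw₁, hs, hp⟩ := exists_cubicFactor hr1 ht ha hx0 (hneg x hmem)
        have hp0 : 0 < p := by nlinarith [sq_nonneg s]
        rw [mpFormula_of_cubicFactor hr0 ht ha hmem hf hx0 hw₁ hs hp]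
        have hP : (x : ℂ) * (ω - w₁) * (ω ^ 2 - s * ω + p) = 0 := by
          have h1 : (x : ℂ) * (w₁ + s) = x + (1 - r) * t := by exact_mod_cast hf.sum
          have h2 : (x : ℂ) * (p + w₁ * s) = t - a := by exact_mod_cast hf.mid
          have h3 : (x : ℂ) * w₁ * p = -a := by exact_mod_cast hf.prod
          field_simp at he
          linear_combination -he - ω ^ 2 * h1 + ω * h2 - h3
        have hne : ω ≠ w₁ := by
          intro h
          rw [h] at hb h0
          have hw : w₁ ≠ 0 := by exact_mod_cast h0
          exact absurd hb (not_le.2 (hf.lt_of_real_root hx0 (lt_of_le_of_ne hw₁ hw) hs hp0))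
        have hq : ω ^ 2 - s * ω + p = 0 := by
          have hxc : (x : ℂ) ≠ 0 := by exact_mod_cast hx
          exact (mul_eq_zero.1 hP).resolve_left (mul_ne_zero hxc (sub_ne_zero.2 hne))
        obtain ⟨u, v⟩ := ω
        have e1 := congrArg Complex.re hq
        have e2 := congrArg Complex.im hq
        simp only [pow_two, Complex.add_im, Complex.sub_im, Complex.mul_im,
          Complex.mul_re, Complex.ofReal_re, Complex.ofReal_im, Complex.add_re, Complex.sub_re,
          Complex.zero_re, Complex.zero_im] at e1 e2
        simp only at hi ⊢
        have hv : v ≠ 0 := by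
          rintro rfl
          nlinarith [sq_nonneg (2 * u - s)]
        have hu : u = s / 2 := by
          have : v * (2 * u - s) = 0 := by linear_combination e2
          have := (mul_eq_zero.1 this).resolve_left hv
          linarith
        have : 4 * p - s ^ 2 = (2 * v) ^ 2 := by
          rw [hu] at e1; linear_combination 4 * e1
        rw [this, Real.sqrt_sq (by linarith)]
        ring
      · rw [mpFormula, Set.indicator_of_notMem hmem, mul_zero]
        by_contra hne
        exact absurd (mpS_neg_of_root hx0 rfl hne he) (not_lt.2 (hpos x hx0 hmem))

end Boundary

/-! ### Recovering a holomorphic function from its boundary density -/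

section HalfPlane

/-- Cauchy's theorem on `[-R, R] × [0, R]`: the other three sides have total length `4 R` and lie in
`‖z‖ ≥ R`. -/
lemma norm_integral_horizontal_le {H : ℂ → ℂ} (hd : ∀ z : ℂ, 0 ≤ z.im → DifferentiableAt ℂ H z)
    {K R : ℝ} (hR : 0 < R) (hb : ∀ z : ℂ, 0 ≤ z.im → R ≤ ‖z‖ → ‖H z‖ ≤ K) :
    ‖∫ x in (-R)..R, H x‖ ≤ 4 * R * K := by
  have hrect := Complex.integral_boundary_rect_eq_zero_of_differentiableOn H (-R : ℂ)
    (R + R * Complex.I) (by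
      intro z hz
      refine (hd z ?_).differentiableWithinAt
      have := hz.2
      simp only [Complex.neg_im, Complex.ofReal_im, neg_zero, Complex.add_im, Complex.mul_im,
        Complex.ofReal_re, Complex.I_im, mul_one, Complex.I_re, mul_zero, add_zero, zero_add,
        Set.mem_preimage, Set.uIcc_of_le hR.le] at this
      exact this.1)
  simp only [Complex.neg_im, Complex.ofReal_im, neg_zero, Complex.add_im, Complex.mul_im,
    Complex.ofReal_re, Complex.I_im, mul_one, Complex.I_re, mul_zero, add_zero, zero_add,
    Complex.neg_re, Complex.add_re, Complex.mul_re, sub_zero, Complex.ofReal_zero, zero_mul,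
    smul_eq_mul] at hrect
  have h1 : ‖∫ x in (-R)..R, H (x + R * Complex.I)‖ ≤ K * |R - -R| := by
    refine intervalIntegral.norm_integral_le_of_norm_le_const fun x _ => hb _ ?_ ?_
    · simp [hR.le]
    · refine le_trans ?_ (Complex.abs_im_le_norm _)
      simp [le_abs_self]
  have h2 : ‖∫ y in (0 : ℝ)..R, H (R + y * Complex.I)‖ ≤ K * |R - 0| := by
    refine intervalIntegral.norm_integral_le_of_norm_le_const fun y hy => hb _ ?_ ?_
    · rw [Set.uIoc_of_le hR.le] at hy
      simpa using hy.1.le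
    · refine le_trans ?_ (Complex.abs_re_le_norm _)
      simp [le_abs_self]
  have h3 : ‖∫ y in (0 : ℝ)..R, H (((-R : ℝ) : ℂ) + y * Complex.I)‖ ≤ K * |R - 0| := by
    refine intervalIntegral.norm_integral_le_of_norm_le_const fun y hy => hb _ ?_ ?_
    · rw [Set.uIoc_of_le hR.le] at hy
      simpa using hy.1.le
    · refine le_trans ?_ (Complex.abs_re_le_norm _)
      simp [le_abs_self]
  have e : ∫ x in (-R)..R, H x = (∫ x in (-R)..R, H (x + R * Complex.I))
      - Complex.I * (∫ y in (0 : ℝ)..R, H (R + y * Complex.I))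
      + Complex.I * (∫ y in (0 : ℝ)..R, H (((-R : ℝ) : ℂ) + y * Complex.I)) := by
    linear_combination hrect
  rw [e]
  refine (norm_add_le _ _).trans ?_
  refine (add_le_add_left (norm_sub_le _ _) _).trans ?_
  rw [norm_mul, norm_mul, Complex.norm_I, one_mul, one_mul]
  rw [sub_neg_eq_add, abs_of_pos (by linarith)] at h1
  rw [sub_zero, abs_of_pos hR] at h2 h3
  linarith

lemma integrable_real_of_decay {H : ℂ → ℂ} (hd : ∀ z : ℂ, 0 ≤ z.im → DifferentiableAt ℂ H z)
    {C R₀ : ℝ} (hb : ∀ z : ℂ, 0 ≤ z.im → R₀ ≤ ‖z‖ → ‖H z‖ ≤ C * ‖z‖ ^ (-(3 / 2) : ℝ)) :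
    Integrable fun x : ℝ => H x := by
  have hcont : Continuous fun x : ℝ => H x := by
    refine continuous_iff_continuousAt.2 fun x => ?_
    exact (hd x (by simp)).continuousAt.comp Complex.continuous_ofReal.continuousAt
  have hint : Integrable fun x : ℝ => (1 + ‖x‖) ^ (-(3 / 2) : ℝ) :=
    integrable_one_add_norm (by simp; norm_num)
  refine hcont.locallyIntegrable.integrable_of_isBigO_cocompact ?_
    (hint.integrableAtFilter (cocompact ℝ))
  refine Asymptotics.IsBigO.of_bound (|C| * 2 ^ (3 / 2 : ℝ)) ?_
  filter_upwards [tendsto_norm_cocompact_atTop.eventually_ge_atTop (max R₀ 1)] with x hx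
  have hx1 : 1 ≤ ‖x‖ := (le_max_right _ _).trans hx
  have h1 := hb x (by simp) (by rw [Complex.norm_real]; exact (le_max_left _ _).trans hx)
  rw [Complex.norm_real] at h1
  refine h1.trans ?_
  rw [Real.norm_of_nonneg (show 0 ≤ (1 + ‖x‖) ^ (-(3 / 2) : ℝ) by positivity), mul_assoc]
  refine mul_le_mul (le_abs_self _) ?_ (by positivity) (abs_nonneg _)
  have h2 : (2 : ℝ) ^ (3 / 2 : ℝ) * (2 * ‖x‖) ^ (-(3 / 2) : ℝ) = ‖x‖ ^ (-(3 / 2) : ℝ) := by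
    rw [Real.mul_rpow (by norm_num) (norm_nonneg _), ← mul_assoc, ← Real.rpow_add (by norm_num)]
    norm_num
  rw [← h2]
  refine mul_le_mul_of_nonneg_left ?_ (by positivity)
  exact Real.rpow_le_rpow_of_nonpos (by positivity) (by linarith) (by norm_num)

/-- The integral over the real line of a function holomorphic on the closed upper half-plane
vanishes if the function decays faster than `1 / z`. -/
lemma integral_real_eq_zero {H : ℂ → ℂ} (hd : ∀ z : ℂ, 0 ≤ z.im → DifferentiableAt ℂ H z)
    {C R₀ : ℝ} (hb : ∀ z : ℂ, 0 ≤ z.im → R₀ ≤ ‖z‖ → ‖H z‖ ≤ C * ‖z‖ ^ (-(3 / 2) : ℝ)) :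
    ∫ x : ℝ, H x = 0 := by
  have hint := integrable_real_of_decay hd hb
  refine tendsto_nhds_unique
    (intervalIntegral_tendsto_integral hint tendsto_neg_atTop_atBot tendsto_id) ?_
  have hlim : Tendsto (fun R : ℝ => 4 * |C| * R ^ (-(1 / 2) : ℝ)) atTop (𝓝 0) := by
    simpa using (tendsto_rpow_neg_atTop (y := 1 / 2) (by norm_num)).const_mul (4 * |C|)
  refine squeeze_zero_norm' ?_ hlim
  filter_upwards [eventually_ge_atTop (max R₀ 1)] with R hR
  have hR1 : 1 ≤ R := (le_max_right _ _).trans hR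
  have hR0 : 0 < R := by linarith
  refine (norm_integral_horizontal_le hd hR0 (K := |C| * R ^ (-(3 / 2) : ℝ))
    fun z hz hRz => ?_).trans_eq ?_
  · refine (hb z hz ((le_max_left _ _).trans (hR.trans hRz))).trans ?_
    refine mul_le_mul (le_abs_self _) ?_ (by positivity) (abs_nonneg _)
    exact Real.rpow_le_rpow_of_nonpos hR0 hRz (by norm_num)
  · have : R ^ (-(1 / 2) : ℝ) = R * R ^ (-(3 / 2) : ℝ) := by
      conv_rhs => rw [← Real.rpow_one_add' hR0.le (by norm_num)]
      norm_num
    rw [this]; ring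

lemma mul_sub_conj (x : ℝ) (z : ℂ) :
    ((x : ℂ) - z) * (x - (starRingEnd ℂ) z) = (((x - z.re) ^ 2 + z.im ^ 2 : ℝ) : ℂ) := by
  apply Complex.ext
  · rw [Complex.ofReal_re]; simp; ring
  · rw [Complex.ofReal_im]; simp; ring

lemma integrable_inv_poisson (x₀ : ℝ) {y : ℝ} (hy : 0 < y) :
    Integrable (fun x : ℝ => ((x - x₀) ^ 2 + y ^ 2)⁻¹) ∧
      ∫ x : ℝ, ((x - x₀) ^ 2 + y ^ 2)⁻¹ = Real.pi / y := by
  lift y to NNReal using hy.le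
  have h1 := ProbabilityTheory.integral_cauchyPDFReal_eq_one x₀ (γ := y)
    (by rintro rfl; simp at hy)
  have h2 : Integrable (ProbabilityTheory.cauchyPDFReal x₀ y) :=
    MeasureTheory.Integrable.of_integral_ne_zero (by rw [h1]; exact one_ne_zero)
  have e : (fun x : ℝ => ((x - x₀) ^ 2 + (y : ℝ) ^ 2)⁻¹)
      = fun x => Real.pi / y * ProbabilityTheory.cauchyPDFReal x₀ y x := by
    funext x
    rw [ProbabilityTheory.cauchyPDFReal_def]
    have := Real.pi_pos
    field_simp
  rw [e]
  exact ⟨h2.const_mul _, by rw [integral_const_mul, h1, mul_one]⟩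

/-- Cauchy's formula on the upper half-plane, written with the imaginary part of the boundary
values. -/
lemma eq_integral_im_boundary {F : ℂ → ℂ} (hd : ∀ z : ℂ, 0 ≤ z.im → DifferentiableAt ℂ F z)
    {C : ℝ} (hb : ∀ z : ℂ, 0 ≤ z.im → z ≠ 0 → ‖F z‖ ≤ C * ‖z‖ ^ (-(1 / 2) : ℝ)) {z₀ : ℂ}
    (hz₀ : 0 < z₀.im) :
    F z₀ = ∫ x : ℝ, ((-(1 / Real.pi) * (F x).im : ℝ) : ℂ) / (z₀ - x) := by
  have hC : 0 ≤ C := by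
    have := (norm_nonneg _).trans (hb 1 (by simp) one_ne_zero)
    simpa using this
  set c := (starRingEnd ℂ) z₀ with hc
  have hcim : c.im = -z₀.im := by simp [hc]
  have hcnorm : ‖c‖ = ‖z₀‖ := by simp [hc]
  have hsub : ∀ z : ℂ, 0 ≤ z.im → z - c ≠ 0 := by
    intro z hz h
    have := congrArg Complex.im h
    rw [Complex.sub_im, hcim, Complex.zero_im] at this
    linarith
  have hsub₀ : ∀ x : ℝ, (x : ℂ) - z₀ ≠ 0 := by
    intro x h
    have := congrArg Complex.im h
    simp at this
    linarith
  have hz₀n : 0 < ‖z₀‖ := norm_pos_iff.2 (ne_zero_of_im_pos hz₀)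
  have hbig : ∀ z v : ℂ, ‖v‖ = ‖z₀‖ → 2 * ‖z₀‖ + 1 ≤ ‖z‖ → ‖z‖ / 2 ≤ ‖z - v‖ := by
    intro z v hv hz
    have := norm_sub_norm_le z v
    rw [hv] at this
    linarith
  have hrpow : ∀ ρ : ℝ, 0 < ρ → ρ ^ (-(3 / 2) : ℝ) = ρ ^ (-(1 / 2) : ℝ) / ρ := by
    intro ρ hρ
    rw [← Real.rpow_sub_one hρ.ne']
    norm_num
  have hbd : ∀ z v : ℂ, 0 ≤ z.im → ‖v‖ = ‖z₀‖ → 2 * ‖z₀‖ + 1 ≤ ‖z‖ →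
      ‖F z / (z - v)‖ ≤ 2 * C * ‖z‖ ^ (-(3 / 2) : ℝ) := by
    intro z v hz hv hzb
    have hzp : 0 < ‖z‖ := by linarith
    rw [norm_div, hrpow _ hzp]
    calc ‖F z‖ / ‖z - v‖ ≤ (C * ‖z‖ ^ (-(1 / 2) : ℝ)) / (‖z‖ / 2) := by
          gcongr
          · exact hb z hz (norm_pos_iff.1 hzp)
          · exact hbig z v hv hzb
      _ = 2 * C * (‖z‖ ^ (-(1 / 2) : ℝ) / ‖z‖) := by field_simp
  -- The pole `c` lies below the real axis. Conjugating this identity makes the integral of `conj F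
  -- / (x - z₀)` vanish, so `F` in Cauchy's formula may be replaced by `F - conj F = 2 i Im F`.
  have hA : ∫ x : ℝ, F x / (x - c) = 0 := by
    refine integral_real_eq_zero (H := fun z => F z / (z - c)) (fun z hz => ?_)
      (C := 2 * C) (R₀ := 2 * ‖z₀‖ + 1) fun z hz hzb => hbd z c hz hcnorm hzb
    exact (hd z hz).fun_div (differentiableAt_id.sub_const c) (hsub z hz)
  have hAint : Integrable fun x : ℝ => F x / (x - c) := by
    refine integrable_real_of_decay (H := fun z => F z / (z - c)) (fun z hz => ?_)
      (C := 2 * C) (R₀ := 2 * ‖z₀‖ + 1) fun z hz hzb => hbd z c hz hcnorm hzb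
    exact (hd z hz).fun_div (differentiableAt_id.sub_const c) (hsub z hz)
  -- the pole itself, removed by subtracting a multiple of `1 / (z - c)`
  set H : ℂ → ℂ := fun z => dslope (fun z => F z * (z - c)) z₀ z / (z - c) with hH
  have hHd : ∀ z : ℂ, 0 ≤ z.im → DifferentiableAt ℂ H z := by
    intro z hz
    refine DifferentiableAt.fun_div ?_ (differentiableAt_id.sub_const c) (hsub z hz)
    have hf : ∀ z : ℂ, 0 ≤ z.im → DifferentiableAt ℂ (fun z => F z * (z - c)) z := fun z hz =>
      (hd z hz).fun_mul (differentiableAt_id.sub_const c)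
    rcases eq_or_ne z z₀ with rfl | hne
    · have hop : {w : ℂ | 0 < w.im} ∈ 𝓝 z :=
        (isOpen_lt continuous_const Complex.continuous_im).mem_nhds hz₀
      refine DifferentiableOn.differentiableAt ?_ hop
      rw [Complex.differentiableOn_dslope hop]
      exact fun w hw => (hf w (le_of_lt hw)).differentiableWithinAt
    · exact (differentiableAt_dslope_of_ne hne).2 (hf z hz)
  obtain ⟨K, hK⟩ : ∃ K, K = F z₀ * (z₀ - c) := ⟨_, rfl⟩
  have hHeq : ∀ z : ℂ, 0 ≤ z.im → z ≠ z₀ → H z = F z / (z - z₀) - K * ((z - z₀) * (z - c))⁻¹ := by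
    intro z hz hne
    have h1 := hsub z hz
    have h2 := sub_ne_zero.2 hne
    simp only [hH, dslope_of_ne _ hne, slope_def_field, hK]
    field_simp
  have hHb : ∀ z : ℂ, 0 ≤ z.im → 2 * ‖z₀‖ + 1 ≤ ‖z‖ →
      ‖H z‖ ≤ (2 * C + 4 * ‖K‖) * ‖z‖ ^ (-(3 / 2) : ℝ) := by
    intro z hz hzb
    have hzp : 1 ≤ ‖z‖ := by linarith
    have hne : z ≠ z₀ := by rintro rfl; linarith
    rw [hHeq z hz hne]
    refine (norm_sub_le _ _).trans ?_
    rw [add_mul]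
    refine add_le_add (hbd z z₀ hz rfl hzb) ?_
    rw [norm_mul, norm_inv, norm_mul]
    have h1 : (‖z - z₀‖ * ‖z - c‖)⁻¹ ≤ (‖z‖ / 2 * (‖z‖ / 2))⁻¹ := by
      gcongr
      · exact hbig z z₀ rfl hzb
      · exact hbig z c hcnorm hzb
    have h2 : (‖z‖ / 2 * (‖z‖ / 2))⁻¹ = 4 * ‖z‖ ^ (-2 : ℝ) := by
      rw [Real.rpow_neg (by positivity), Real.rpow_two]; field_simp; norm_num
    have h3 : ‖z‖ ^ (-2 : ℝ) ≤ ‖z‖ ^ (-(3 / 2) : ℝ) :=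
      Real.rpow_le_rpow_of_exponent_le hzp (by norm_num)
    calc ‖K‖ * (‖z - z₀‖ * ‖z - c‖)⁻¹ ≤ ‖K‖ * (4 * ‖z‖ ^ (-(3 / 2) : ℝ)) := by
          gcongr; exact h1.trans (h2.trans_le (by gcongr))
      _ = _ := by ring
  have hB := integral_real_eq_zero hHd hHb
  have hBint := integrable_real_of_decay hHd hHb
  obtain ⟨hPint, hP⟩ := integrable_inv_poisson z₀.re hz₀
  have hPc : ∀ x : ℝ, (((x : ℂ) - z₀) * (x - c))⁻¹ = (((x - z₀.re) ^ 2 + z₀.im ^ 2)⁻¹ : ℝ) := by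
    intro x; rw [mul_sub_conj]; push_cast; rfl
  have hxz : ∀ x : ℝ, F x / (x - z₀) = H x + K * (((x - z₀.re) ^ 2 + z₀.im ^ 2)⁻¹ : ℝ) := by
    intro x
    rw [hHeq x (by simp) (sub_ne_zero.1 (hsub₀ x)), hPc]; ring
  have hPint' : Integrable fun x : ℝ =>
      K * ((((x - z₀.re) ^ 2 + z₀.im ^ 2)⁻¹ : ℝ) : ℂ) := hPint.ofReal.const_mul K
  have hCint : Integrable fun x : ℝ => F x / (x - z₀) := by
    simp only [hxz]
    exact hBint.add hPint'
  have hCval : ∫ x : ℝ, F x / (x - z₀) = 2 * Real.pi * Complex.I * F z₀ := by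
    simp only [hxz]
    rw [integral_add hBint hPint', hB, integral_const_mul, integral_complex_ofReal, hP,
      hK]
    have : z₀ - c = 2 * z₀.im * Complex.I := by
      apply Complex.ext <;> simp [hc]; ring
    rw [this]
    have : (z₀.im : ℂ) ≠ 0 := by exact_mod_cast hz₀.ne'
    push_cast
    field_simp
    ring
  have hconj : ∀ x : ℝ, (starRingEnd ℂ) (F x / (x - c)) = (starRingEnd ℂ) (F x) / (x - z₀) := by
    intro x; rw [map_div₀, map_sub, Complex.conj_ofReal, hc, Complex.conj_conj]
  have hAc : ∫ x : ℝ, (starRingEnd ℂ) (F x) / (x - z₀) = 0 := by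
    simp only [← hconj]
    rw [integral_conj, hA, map_zero]
  have hAcint : Integrable fun x : ℝ => (starRingEnd ℂ) (F x) / (x - z₀) := by
    simp only [← hconj]
    exact (LinearIsometryEquiv.integrable_comp_iff Complex.conjLIE).2 hAint
  have hfin : ∀ x : ℝ, ((-(1 / Real.pi) * (F x).im : ℝ) : ℂ) / (z₀ - x)
      = (2 * Real.pi * Complex.I)⁻¹ * (F x / (x - z₀) - (starRingEnd ℂ) (F x) / (x - z₀)) := by
    intro x
    have h1 := hsub₀ x
    have h2 : z₀ - x ≠ 0 := by rw [← neg_sub]; exact neg_ne_zero.2 h1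
    have h3 := Complex.sub_conj (F x)
    have hpi : (Real.pi : ℂ) ≠ 0 := by exact_mod_cast Real.pi_ne_zero
    rw [← sub_div, h3, ← neg_sub (x : ℂ) z₀]
    push_cast
    field_simp
  simp only [hfin]
  rw [integral_const_mul, integral_sub hCint hAcint, hCval, hAc, sub_zero]
  have hpi : (Real.pi : ℂ) ≠ 0 := by exact_mod_cast Real.pi_ne_zero
  have := Complex.I_ne_zero
  field_simp

/-- The majorant for the boundary integrals: `|x| ^ (-1/2)` bounds the function and `1 / (1 + |x|)`
the kernel. -/
lemma integrable_abs_rpow_mul_inv :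
    Integrable fun x : ℝ => |x| ^ (-(1 / 2) : ℝ) * (1 + |x|)⁻¹ := by
  have hpos : IntegrableOn (fun x : ℝ => |x| ^ (-(1 / 2) : ℝ) * (1 + |x|)⁻¹) (Set.Ioi 0) := by
    have hmeas : Measurable fun x : ℝ => |x| ^ (-(1 / 2) : ℝ) * (1 + |x|)⁻¹ := by fun_prop
    rw [← Set.Ioc_union_Ioi_eq_Ioi zero_le_one]
    refine IntegrableOn.union ?_ ?_
    · have h : IntegrableOn (fun x : ℝ => x ^ (-(1 / 2) : ℝ)) (Set.Ioc 0 1) :=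
        (intervalIntegrable_iff_integrableOn_Ioc_of_le zero_le_one).1
          (intervalIntegral.intervalIntegrable_rpow' (by norm_num))
      refine Integrable.mono' h hmeas.aestronglyMeasurable ?_
      filter_upwards [ae_restrict_mem measurableSet_Ioc] with x hx
      rw [Real.norm_of_nonneg (by positivity), abs_of_pos hx.1]
      have : (1 + x)⁻¹ ≤ 1 := inv_le_one_of_one_le₀ (by linarith [hx.1])
      exact mul_le_of_le_one_right (Real.rpow_nonneg hx.1.le _) this
    · have h : IntegrableOn (fun x : ℝ => x ^ (-(3 / 2) : ℝ)) (Set.Ioi 1) :=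
        integrableOn_Ioi_rpow_of_lt (by norm_num) one_pos
      refine Integrable.mono' h hmeas.aestronglyMeasurable ?_
      filter_upwards [ae_restrict_mem measurableSet_Ioi] with x hx
      have hx0 : 0 < x := lt_trans one_pos hx
      rw [Real.norm_of_nonneg (by positivity), abs_of_pos hx0]
      have e : x ^ (-(3 / 2) : ℝ) = x ^ (-(1 / 2) : ℝ) * x⁻¹ := by
        rw [← div_eq_mul_inv, ← Real.rpow_sub_one hx0.ne']; norm_num
      rw [e]
      gcongr
      linarith
  rw [← integrableOn_univ, ← Set.Iic_union_Ioi (a := (0 : ℝ)), integrableOn_union]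
  refine ⟨?_, hpos⟩
  rw [integrableOn_Iic_iff_integrableOn_Iio]
  have m : MeasurableEmbedding fun x : ℝ => -x := (Homeomorph.neg ℝ).measurableEmbedding
  rw [← Measure.map_neg_eq_self (volume : Measure ℝ), m.integrableOn_map_iff]
  simpa [Function.comp_def] using hpos

/-- A function holomorphic on the upper half-plane and bounded by a multiple of `|z| ^ (-1 / 2)` is
the Stieltjes transform of its boundary density. -/
lemma eq_greenFn_of_boundary {F : ℂ → ℂ} (hd : ∀ z : ℂ, 0 < z.im → DifferentiableAt ℂ F z)
    {C : ℝ} (hb : ∀ z : ℂ, 0 < z.im → ‖F z‖ ≤ C * ‖z‖ ^ (-(1 / 2) : ℝ)) {ρ : ℝ → ℝ}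
    (hlim : ∀ x : ℝ, x ≠ 0 → Tendsto (fun ε : ℝ => -(1 / Real.pi) * (F (x + ε * Complex.I)).im)
      (𝓝[>] 0) (𝓝 (ρ x))) {z₀ : ℂ} (hz₀ : 0 < z₀.im) : F z₀ = greenFn ρ z₀ := by
  have hC : 0 ≤ C := by
    have := (norm_nonneg _).trans (hb Complex.I (by simp))
    simpa using this
  have him : ∀ {z : ℂ} {ε : ℝ}, 0 ≤ z.im → 0 < ε → 0 < (z + ε * Complex.I).im := by
    intro z ε hz hε; simp; linarith
  have hle : ∀ {z : ℂ} {ε : ℝ}, 0 ≤ z.im → 0 < ε → ‖z‖ ≤ ‖z + ε * Complex.I‖ := by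
    intro z ε hz hε
    refine (sq_le_sq₀ (norm_nonneg _) (norm_nonneg _)).1 ?_
    rw [Complex.sq_norm, Complex.sq_norm, Complex.normSq_apply, Complex.normSq_apply]
    simp
    nlinarith
  -- Moving up by `ε` increases the norm, so the shifted functions, holomorphic up to the real axis,
  -- share one bound independent of `ε`.
  have hb' : ∀ ε : ℝ, 0 < ε → ∀ z : ℂ, 0 ≤ z.im → z ≠ 0 →
      ‖F (z + ε * Complex.I)‖ ≤ C * ‖z‖ ^ (-(1 / 2) : ℝ) := by
    intro ε hε z hz hz0
    refine (hb _ (him hz hε)).trans ?_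
    gcongr C * ?_
    exact Real.rpow_le_rpow_of_nonpos (norm_pos_iff.2 hz0) (hle hz hε) (by norm_num)
  have hd' : ∀ ε : ℝ, 0 < ε → ∀ z : ℂ, 0 ≤ z.im →
      DifferentiableAt ℂ (fun z => F (z + ε * Complex.I)) z := by
    intro ε hε z hz
    exact (hd _ (him hz hε)).comp z (differentiableAt_id.add_const _)
  have heq : ∀ ε : ℝ, 0 < ε → F (z₀ + ε * Complex.I) =
      ∫ x : ℝ, ((-(1 / Real.pi) * (F (x + ε * Complex.I)).im : ℝ) : ℂ) / (z₀ - x) :=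
    fun ε hε => eq_integral_im_boundary (hd' ε hε) (hb' ε hε) hz₀
  have hsub₀ : ∀ x : ℝ, z₀ - (x : ℂ) ≠ 0 := by
    intro x h
    have := congrArg Complex.im h
    simp at this
    linarith
  have l1 : Tendsto (fun ε : ℝ => F (z₀ + ε * Complex.I)) (𝓝[>] 0) (𝓝 (F z₀)) := by
    have hcont : ContinuousAt (fun ε : ℝ => F (z₀ + ε * Complex.I)) 0 := by
      refine ContinuousAt.comp (g := F) ?_ (by fun_prop)
      simpa using (hd z₀ hz₀).continuousAt
    have := hcont.tendsto
    simp only [Complex.ofReal_zero, zero_mul, add_zero] at this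
    exact this.mono_left nhdsWithin_le_nhds
  -- Chosen so that `1 + |x| ≤ M ‖z₀ - x‖`, using `‖z₀ - x‖ ≥ z₀.im`.
  set M := 1 + (1 + ‖z₀‖) / z₀.im with hM
  have hM0 : 0 < M := by positivity
  have hMx : ∀ x : ℝ, 1 + |x| ≤ M * ‖z₀ - x‖ := by
    intro x
    have h1 : z₀.im ≤ ‖z₀ - x‖ := by
      have := Complex.abs_im_le_norm (z₀ - x)
      simp only [Complex.sub_im, Complex.ofReal_im, sub_zero] at this
      exact (le_abs_self _).trans this
    have h2 : |x| ≤ ‖z₀‖ + ‖z₀ - x‖ := by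
      have := norm_sub_le z₀ (z₀ - x)
      rwa [sub_sub_cancel, Complex.norm_real, Real.norm_eq_abs] at this
    have h3 : 1 + ‖z₀‖ ≤ (1 + ‖z₀‖) / z₀.im * ‖z₀ - x‖ := by
      rw [div_mul_eq_mul_div, le_div_iff₀ hz₀]
      gcongr
    rw [hM, add_mul, one_mul]
    linarith
  have l2 : Tendsto (fun ε : ℝ =>
      ∫ x : ℝ, ((-(1 / Real.pi) * (F (x + ε * Complex.I)).im : ℝ) : ℂ) / (z₀ - x)) (𝓝[>] 0)
      (𝓝 (greenFn ρ z₀)) := by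
    refine tendsto_integral_filter_of_dominated_convergence
      (fun x => 1 / Real.pi * C * M * (|x| ^ (-(1 / 2) : ℝ) * (1 + |x|)⁻¹)) ?_ ?_
      (integrable_abs_rpow_mul_inv.const_mul _) ?_
    · filter_upwards [self_mem_nhdsWithin] with ε hε
      refine Continuous.aestronglyMeasurable ?_
      refine Continuous.div ?_ (by fun_prop) hsub₀
      refine Complex.continuous_ofReal.comp (continuous_const.mul (Complex.continuous_im.comp ?_))
      refine continuous_iff_continuousAt.2 fun x => ?_
      exact (hd' ε hε x (by simp)).continuousAt.comp Complex.continuous_ofReal.continuousAt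
    · filter_upwards [self_mem_nhdsWithin] with ε hε
      have h0 : ∀ᵐ x : ℝ, x ≠ 0 := by
        simp [ae_iff]
      filter_upwards [h0] with x hx
      have h1 := hb' ε hε x (by simp) (by exact_mod_cast hx)
      rw [Complex.norm_real, Real.norm_eq_abs] at h1
      have h2 := Complex.abs_im_le_norm (F (x + ε * Complex.I))
      have h3 : 0 < ‖z₀ - x‖ := norm_pos_iff.2 (hsub₀ x)
      rw [norm_div, Complex.norm_real, norm_mul, norm_neg,
        Real.norm_of_nonneg (by have := Real.pi_pos; positivity), Real.norm_eq_abs, div_le_iff₀ h3]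
      have h4 : 1 ≤ M * (1 + |x|)⁻¹ * ‖z₀ - x‖ := by
        have := hMx x
        rw [mul_right_comm, ← div_eq_mul_inv, le_div_iff₀ (by positivity)]
        linarith
      have hpi := Real.pi_pos
      calc 1 / Real.pi * |(F (x + ε * Complex.I)).im|
          ≤ 1 / Real.pi * (C * |x| ^ (-(1 / 2) : ℝ)) * 1 := by
            rw [mul_one]; gcongr; exact h2.trans h1
        _ ≤ 1 / Real.pi * (C * |x| ^ (-(1 / 2) : ℝ)) * (M * (1 + |x|)⁻¹ * ‖z₀ - x‖) := by
            gcongr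
        _ = _ := by ring
    · have h0 : ∀ᵐ x : ℝ, x ≠ 0 := by
        simp [ae_iff]
      filter_upwards [h0] with x hx
      exact ((Complex.continuous_ofReal.tendsto _).comp (hlim x hx)).div_const _
  refine tendsto_nhds_unique l1 (l2.congr' ?_)
  filter_upwards [self_mem_nhdsWithin] with ε hε
  exact (heq ε hε).symm

end HalfPlane

/-! ### Green's functions of integrable densities and Stieltjes inversion -/

section Green

lemma abs_im_le_norm_sub_real (z : ℂ) (x : ℝ) : |z.im| ≤ ‖z - x‖ := by
  simpa using Complex.abs_im_le_norm (z - x)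

lemma sub_real_ne_zero {z : ℂ} (hz : z.im ≠ 0) (x : ℝ) : z - x ≠ 0 := by
  intro h
  have := congrArg Complex.im h
  simp at this
  exact hz this

lemma norm_div_sub_le (c : ℝ) {z : ℂ} (hz : z.im ≠ 0) (x : ℝ) :
    ‖(c : ℂ) / (z - x)‖ ≤ |z.im|⁻¹ * |c| := by
  rw [norm_div, Complex.norm_real, Real.norm_eq_abs, div_eq_mul_inv, mul_comm]
  have := abs_pos.2 hz
  gcongr
  exact abs_im_le_norm_sub_real z x

lemma continuous_inv_sub {z : ℂ} (hz : z.im ≠ 0) : Continuous fun x : ℝ => (z - (x : ℂ))⁻¹ :=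
  (by fun_prop : Continuous fun x : ℝ => z - (x : ℂ)).inv₀ (sub_real_ne_zero hz)

lemma aestronglyMeasurable_greenFn {ρ : ℝ → ℝ} (hρ : AEStronglyMeasurable ρ) {z : ℂ}
    (hz : z.im ≠ 0) : AEStronglyMeasurable fun x : ℝ => (ρ x : ℂ) / (z - (x : ℂ)) := by
  simp only [div_eq_mul_inv]
  exact (Complex.continuous_ofReal.comp_aestronglyMeasurable hρ).mul
    (continuous_inv_sub hz).aestronglyMeasurable

lemma integrable_greenFn {ρ : ℝ → ℝ} (hρ : Integrable ρ) {z : ℂ} (hz : z.im ≠ 0) :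
    Integrable fun x : ℝ => (ρ x : ℂ) / (z - (x : ℂ)) :=
  (hρ.abs.const_mul |z.im|⁻¹).mono' (aestronglyMeasurable_greenFn hρ.aestronglyMeasurable hz)
    (Eventually.of_forall fun x => norm_div_sub_le _ hz x)

lemma im_div_sub (c : ℝ) (z : ℂ) (x : ℝ) :
    ((c : ℂ) / (z - x)).im = -(c * (z.im / ((x - z.re) ^ 2 + z.im ^ 2))) := by
  rw [div_eq_mul_inv, Complex.im_ofReal_mul, Complex.inv_im, Complex.normSq_apply]
  simp only [Complex.sub_im, Complex.ofReal_im, sub_zero, Complex.sub_re, Complex.ofReal_re]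
  ring_nf

lemma greenFn_im {ρ : ℝ → ℝ} (hρ : Integrable ρ) {z : ℂ} (hz : z.im ≠ 0) :
    (greenFn ρ z).im = -∫ x : ℝ, ρ x * (z.im / ((x - z.re) ^ 2 + z.im ^ 2)) := by
  have h := integral_im (𝕜 := ℂ) (integrable_greenFn hρ hz)
  simp only [RCLike.im_to_complex] at h
  rw [greenFn, ← h, ← integral_neg]
  simp only [im_div_sub]

lemma greenFn_norm_le {ρ : ℝ → ℝ} (h0 : ∀ x, 0 ≤ ρ x) (hρ : Integrable ρ) (h1 : ∫ x, ρ x = 1)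
    {z : ℂ} (hz : z.im ≠ 0) : ‖greenFn ρ z‖ ≤ |z.im|⁻¹ := by
  refine (norm_integral_le_of_norm_le (hρ.const_mul |z.im|⁻¹)
    (Eventually.of_forall fun x => ?_)).trans_eq ?_
  · simpa [abs_of_nonneg (h0 x)] using norm_div_sub_le (ρ x) hz x
  · rw [integral_const_mul, h1, mul_one]

lemma greenFn_im_neg {ρ : ℝ → ℝ} (h0 : ∀ x, 0 ≤ ρ x) (hρ : Integrable ρ) (h1 : ∫ x, ρ x = 1)
    {z : ℂ} (hz : 0 < z.im) : (greenFn ρ z).im < 0 := by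
  rw [greenFn_im hρ hz.ne', neg_lt_zero]
  have hnn : ∀ x, 0 ≤ ρ x * (z.im / ((x - z.re) ^ 2 + z.im ^ 2)) := fun x =>
    mul_nonneg (h0 x) (by positivity)
  have hint : Integrable fun x => ρ x * (z.im / ((x - z.re) ^ 2 + z.im ^ 2)) := by
    have := (integrable_greenFn hρ hz.ne').im.neg
    refine this.congr (Eventually.of_forall fun x => ?_)
    simp [im_div_sub]
  refine lt_of_le_of_ne (integral_nonneg hnn) fun h => ?_
  have h2 := (integral_eq_zero_iff_of_nonneg hnn hint).1 h.symm
  have h3 : ρ =ᵐ[volume] 0 := by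
    filter_upwards [h2] with x hx
    refine (mul_eq_zero.1 hx).resolve_right (ne_of_gt ?_)
    positivity
  rw [integral_congr_ae h3] at h1
  simp at h1

lemma continuousAt_greenFn {ρ : ℝ → ℝ} (hρ : Integrable ρ) {z : ℂ} (hz : 0 < z.im) :
    ContinuousAt (greenFn ρ) z := by
  have hev : ∀ᶠ v : ℂ in 𝓝 z, z.im / 2 < v.im :=
    Complex.continuous_im.continuousAt.eventually_const_lt (half_lt_self hz)
  refine continuousAt_of_dominated (bound := fun x => (z.im / 2)⁻¹ * |ρ x|) ?_ ?_
    (hρ.abs.const_mul _) (Eventually.of_forall fun x => ?_)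
  · filter_upwards [hev] with v hv
    exact aestronglyMeasurable_greenFn hρ.aestronglyMeasurable (by linarith : 0 < v.im).ne'
  · filter_upwards [hev] with v hv
    have hv0 : 0 < v.im := by linarith
    refine Eventually.of_forall fun x => (norm_div_sub_le _ hv0.ne' x).trans ?_
    rw [abs_of_pos hv0]
    gcongr
  · exact continuousAt_const.div (continuousAt_id.sub continuousAt_const)
      (sub_real_ne_zero hz.ne' x)

lemma greenFn_conj (ρ : ℝ → ℝ) (z : ℂ) :
    greenFn ρ ((starRingEnd ℂ) z) = (starRingEnd ℂ) (greenFn ρ z) := by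
  rw [greenFn, greenFn, ← integral_conj]
  simp

lemma greenFn_sub {ρ₁ ρ₂ : ℝ → ℝ} (h₁ : Integrable ρ₁) (h₂ : Integrable ρ₂) {z : ℂ}
    (hz : z.im ≠ 0) : greenFn (fun x => ρ₁ x - ρ₂ x) z = greenFn ρ₁ z - greenFn ρ₂ z := by
  rw [greenFn, greenFn, greenFn, ← integral_sub (integrable_greenFn h₁ hz)
    (integrable_greenFn h₂ hz)]
  simp [sub_div]

lemma integral_poisson_kernel (a b s : ℝ) {ε : ℝ} (hε : 0 < ε) :
    ∫ x in a..b, ε / ((s - x) ^ 2 + ε ^ 2)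
      = Real.arctan ((b - s) / ε) - Real.arctan ((a - s) / ε) := by
  have hcont : Continuous fun x : ℝ => ε / ((s - x) ^ 2 + ε ^ 2) :=
    continuous_const.div (by fun_prop) fun x => by positivity
  refine intervalIntegral.integral_eq_sub_of_hasDerivAt
    (f := fun x => Real.arctan ((x - s) / ε)) (fun x _ => ?_)
    (hcont.intervalIntegrable _ _)
  have h := (((hasDerivAt_id x).sub_const s).div_const ε).arctan
  refine h.congr_deriv ?_
  simp only [id]
  field_simp
  ring

lemma tendsto_arctan_div {c : ℝ} (hc : c ≠ 0) :
    Tendsto (fun ε : ℝ => Real.arctan (c / ε)) (𝓝[>] 0)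
      (𝓝 (if 0 < c then Real.pi / 2 else -(Real.pi / 2))) := by
  have hinv : Tendsto (fun ε : ℝ => ε⁻¹) (𝓝[>] 0) atTop := tendsto_inv_nhdsGT_zero
  simp only [div_eq_mul_inv c]
  split_ifs with h
  · exact (Real.tendsto_arctan_atTop.mono_right nhdsWithin_le_nhds).comp
      (hinv.const_mul_atTop h)
  · exact (Real.tendsto_arctan_atBot.mono_right nhdsWithin_le_nhds).comp
      (hinv.const_mul_atTop_of_neg (lt_of_le_of_ne (not_lt.1 h) hc))

/-- Stieltjes inversion: integrating `Im G` over `[a, b] + i ε` and exchanging integrals pairs `f`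
with a difference of arctangents, which tends boundedly to `π` times the indicator of the interval.
-/
lemma setIntegral_eq_zero_of_greenFn_eq_zero {f : ℝ → ℝ} (hf : Integrable f)
    (h : ∀ z : ℂ, 0 < z.im → greenFn f z = 0) {a b : ℝ} (hab : a ≤ b) :
    ∫ x in a..b, f x = 0 := by
  have key : ∀ ε : ℝ, 0 < ε →
      ∫ s, f s * (Real.arctan ((b - s) / ε) - Real.arctan ((a - s) / ε)) = 0 := by
    intro ε hε
    have h1 : ∀ x : ℝ, ∫ s, f s * (ε / ((s - x) ^ 2 + ε ^ 2)) = 0 := by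
      intro x
      have hz : 0 < ((x : ℂ) + ε * Complex.I).im := by simpa using hε
      have h2 := greenFn_im hf hz.ne'
      rw [h _ hz] at h2
      simpa using h2
    have hswap : ∫ x in Set.Ioc a b, ∫ s, f s * (ε / ((s - x) ^ 2 + ε ^ 2))
        = ∫ s, ∫ x in Set.Ioc a b, f s * (ε / ((s - x) ^ 2 + ε ^ 2)) := by
      refine integral_integral_swap ?_
      have hk : Continuous fun p : ℝ × ℝ => ε / ((p.2 - p.1) ^ 2 + ε ^ 2) :=
        continuous_const.div (by fun_prop) fun p => by positivity
      refine Integrable.mul_bdd (c := ε⁻¹) (hf.comp_snd _) hk.aestronglyMeasurable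
        (Eventually.of_forall fun p => ?_)
      rw [Real.norm_of_nonneg (by positivity), div_le_iff₀ (by positivity), inv_mul_eq_div,
        le_div_iff₀ hε]
      nlinarith [sq_nonneg (p.2 - p.1)]
    simp only [h1, integral_zero, integral_const_mul] at hswap
    rw [hswap]
    congr 1
    funext s
    rw [← intervalIntegral.integral_of_le hab, integral_poisson_kernel a b s hε]
  have hlim : Tendsto (fun ε : ℝ =>
      ∫ s, f s * (Real.arctan ((b - s) / ε) - Real.arctan ((a - s) / ε))) (𝓝[>] 0)
      (𝓝 (∫ s, (Set.Ioc a b).indicator (fun s => f s * Real.pi) s)) := by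
    refine tendsto_integral_filter_of_dominated_convergence (fun s => |f s| * Real.pi) ?_ ?_
      (hf.abs.mul_const _) ?_
    · filter_upwards [self_mem_nhdsWithin] with ε hε
      refine hf.aestronglyMeasurable.mul (Continuous.aestronglyMeasurable ?_)
      fun_prop
    · refine Eventually.of_forall fun ε => Eventually.of_forall fun s => ?_
      rw [norm_mul, Real.norm_eq_abs, Real.norm_eq_abs]
      gcongr
      have h1 := Real.arctan_lt_pi_div_two ((b - s) / ε)
      have h2 := Real.neg_pi_div_two_lt_arctan ((b - s) / ε)
      have h3 := Real.arctan_lt_pi_div_two ((a - s) / ε)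
      have h4 := Real.neg_pi_div_two_lt_arctan ((a - s) / ε)
      rw [abs_le]; constructor <;> linarith
    · have ha : ∀ᵐ s : ℝ, s ≠ a := by simp [ae_iff]
      have hb : ∀ᵐ s : ℝ, s ≠ b := by simp [ae_iff]
      filter_upwards [ha, hb] with s hsa hsb
      have hl := ((tendsto_arctan_div (sub_ne_zero.2 hsb.symm)).sub
        (tendsto_arctan_div (sub_ne_zero.2 hsa.symm))).const_mul (f s)
      convert hl using 2
      simp only [sub_pos]
      by_cases h1 : s < b
      · by_cases h2 : s < a
        · rw [if_pos h1, if_pos h2, Set.indicator_of_notMem (fun h => by linarith [h.1])]; ring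
        · rw [if_pos h1, if_neg h2,
            Set.indicator_of_mem (show s ∈ Set.Ioc a b from
              ⟨lt_of_le_of_ne (not_lt.1 h2) hsa.symm, h1.le⟩)]; ring
      · rw [if_neg h1, if_neg (by linarith), Set.indicator_of_notMem
          (fun h => hsb (le_antisymm h.2 (not_lt.1 h1)))]; ring
  have hzero : ∫ s, (Set.Ioc a b).indicator (fun s => f s * Real.pi) s = 0 := by
    refine tendsto_nhds_unique hlim (tendsto_const_nhds.congr' ?_)
    filter_upwards [self_mem_nhdsWithin] with ε hε
    exact (key ε hε).symm
  rw [integral_indicator measurableSet_Ioc, integral_mul_const] at hzero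
  rw [intervalIntegral.integral_of_le hab]
  exact (mul_eq_zero.1 hzero).resolve_right Real.pi_ne_zero

/-- An integrable function is determined by its Stieltjes transform on the upper half-plane. -/
lemma ae_eq_of_greenFn_eq {ρ₁ ρ₂ : ℝ → ℝ} (h₁ : Integrable ρ₁) (h₂ : Integrable ρ₂)
    (h : ∀ z : ℂ, 0 < z.im → greenFn ρ₁ z = greenFn ρ₂ z) : ρ₁ =ᵐ[volume] ρ₂ := by
  have hf : Integrable fun x => ρ₁ x - ρ₂ x := h₁.sub h₂
  have hG : ∀ z : ℂ, 0 < z.im → greenFn (fun x => ρ₁ x - ρ₂ x) z = 0 := fun z hz => by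
    rw [greenFn_sub h₁ h₂ hz.ne', h z hz, sub_self]
  have hI : (fun x => ∫ s in (0 : ℝ)..x, (ρ₁ s - ρ₂ s)) = fun _ => 0 := by
    funext x
    rcases le_total 0 x with hx | hx
    · exact setIntegral_eq_zero_of_greenFn_eq_zero hf hG hx
    · rw [intervalIntegral.integral_symm, setIntegral_eq_zero_of_greenFn_eq_zero hf hG hx, neg_zero]
  -- Lebesgue differentiation: the primitive of `ρ₁ - ρ₂` vanishes identically, hence so does its
  -- derivative, almost everywhere equal to `ρ₁ - ρ₂`.
  filter_upwards [_root_.LocallyIntegrable.ae_hasDerivAt_integral hf.locallyIntegrable] with x hx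
  have h3 := hx 0
  rw [hI] at h3
  exact sub_eq_zero.1 (h3.unique (hasDerivAt_const x (0 : ℝ)))

end Green

/-! ### The formula is the MP density -/

section Assembly
variable {r t a : ℝ}

lemma eq_of_green_eq {z G : ℂ} (hG : G ≠ 0) (hw : 1 - (r : ℂ) * t * G ≠ 0)
    (h : z = 1 / G + (t : ℂ) / (1 - r * t * G) + (a : ℂ) / (1 - r * t * G) ^ 2) :
    (1 - (1 - r * t * G)) * (z * (1 - r * t * G) - (1 - r) * t - a / (1 - r * t * G)) = r * t := by
  rw [h]
  field_simp
  ring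

lemma green_eq_of_eq (hr0 : 0 < r) (ht : 0 < t) {z w : ℂ} (hw : w ≠ 0)
    (h : (1 - w) * (z * w - (1 - r) * t - a / w) = r * t) :
    z = 1 / ((1 - w) / (r * t)) + (t : ℂ) / (1 - r * t * ((1 - w) / (r * t)))
      + (a : ℂ) / (1 - r * t * ((1 - w) / (r * t))) ^ 2 := by
  obtain ⟨h1, h2⟩ := (eq_iff_branchInv hr0 ht hw).1 h
  have hr : (r : ℂ) ≠ 0 := by exact_mod_cast hr0.ne'
  have ht' : (t : ℂ) ≠ 0 := by exact_mod_cast ht.ne'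
  have e : (1 : ℂ) - r * t * ((1 - w) / (r * t)) = w := by field_simp; ring
  rw [e, ← h2, branchInv, one_div_div]

/-- `Im w > 0` because `Im G < 0`. `Im (z w)` is continuous, never zero by `mul_im_ne_zero`, and
positive high on the imaginary axis, hence positive throughout. -/
lemma IsMPDensity.isBranch (hr0 : 0 < r) (hr1 : r ≤ 1) (ht : 0 < t) {ρ : ℝ → ℝ}
    (h : IsMPDensity r t a ρ) {z : ℂ} (hz : 0 < z.im) :
    IsBranch r t a z (1 - r * t * greenFn ρ z) := by
  have hrt : 0 < r * t := mul_pos hr0 ht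
  have him : ∀ z : ℂ, 0 < z.im → 0 < (1 - (r : ℂ) * t * greenFn ρ z).im := by
    intro z hz
    have h1 := greenFn_im_neg h.nonneg h.integrable h.integral_eq_one hz
    rw [← Complex.ofReal_mul, Complex.sub_im, Complex.im_ofReal_mul, Complex.one_im]
    nlinarith
  have heq : ∀ z : ℂ, 0 < z.im →
      (1 - (1 - r * t * greenFn ρ z)) * (z * (1 - r * t * greenFn ρ z) - (1 - r) * t
        - a / (1 - r * t * greenFn ρ z)) = r * t := by
    intro z hz
    refine eq_of_green_eq ?_ (ne_zero_of_im_pos (him z hz)) (h.green_eq z hz.ne')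
    intro h0
    have h1 := greenFn_im_neg h.nonneg h.integrable h.integral_eq_one hz
    rw [h0] at h1
    simp at h1
  refine ⟨him z hz, ?_, heq z hz⟩
  by_contra hneg
  set p : ℂ → ℝ := fun z => (z * (1 - r * t * greenFn ρ z)).im with hp
  have hcont : ContinuousOn p {z : ℂ | 0 < z.im} := by
    intro v hv
    refine ContinuousAt.continuousWithinAt ?_
    exact Complex.continuous_im.continuousAt.comp (continuousAt_id.mul
      (continuousAt_const.sub (continuousAt_const.mul (continuousAt_greenFn h.integrable hv))))
  -- At `z = i y` one has `Im (z w) = y Re w`, and `|G| ≤ 1 / y` with `y > r t` makes `Re w`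
  -- positive.
  set y := r * t + 1 with hy
  have hy0 : 0 < y := by positivity
  have hyim : (y * Complex.I : ℂ).im = y := by simp
  have hyI : 0 < (y * Complex.I : ℂ).im := by rwa [hyim]
  have hpy : 0 < p (y * Complex.I) := by
    have h1 := greenFn_norm_le h.nonneg h.integrable h.integral_eq_one hyI.ne'
    rw [hyim, abs_of_pos hy0] at h1
    have h2 := (Complex.re_le_norm _).trans h1
    have e : p (y * Complex.I) = y * (1 - r * t * (greenFn ρ (y * Complex.I)).re) := by
      simp only [hp]
      rw [← Complex.ofReal_mul, mul_assoc, Complex.im_ofReal_mul, Complex.I_mul_im, Complex.sub_re,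
        Complex.one_re, Complex.re_ofReal_mul]
    rw [e]
    have h3 : r * t * (greenFn ρ (y * Complex.I)).re ≤ r * t * y⁻¹ := by gcongr
    have h4 : r * t * y⁻¹ < 1 := by
      rw [← div_eq_mul_inv, div_lt_one hy0]; linarith
    have : 0 < 1 - r * t * (greenFn ρ (y * Complex.I)).re := by linarith
    positivity
  obtain ⟨v, hv, hv0⟩ := (convex_halfSpace_im_gt 0).isPreconnected.intermediate_value hz hyI hcont
    (show (0 : ℝ) ∈ Set.Icc _ _ from ⟨not_lt.1 hneg, hpy.le⟩)
  exact mul_im_ne_zero hr0 hr1 ht hv (him v hv) (heq v hv) hv0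

/-- The Green's function expressed through the physical branch. -/
noncomputable def branchGreen (r t a : ℝ) (z : ℂ) : ℂ := (1 - branch r t a z) / (r * t)

lemma IsMPDensity.greenFn_eq (hr0 : 0 < r) (hr1 : r ≤ 1) (ht : 0 < t) (ha : 0 ≤ a) {ρ : ℝ → ℝ}
    (h : IsMPDensity r t a ρ) {z : ℂ} (hz : 0 < z.im) : greenFn ρ z = branchGreen r t a z := by
  have h1 := (h.isBranch hr0 hr1 ht hz).unique hr0 hr1 ht ha hz
    (isBranch_branch hr0 hr1 ht ha hz)
  have hr : (r : ℂ) ≠ 0 := by exact_mod_cast hr0.ne'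
  have ht' : (t : ℂ) ≠ 0 := by exact_mod_cast ht.ne'
  rw [branchGreen, ← h1]
  field_simp
  ring

/-- `IsBranch.bound` without its `a` term. It holds near `0` as well as near infinity, so one
estimate controls both the possible singularity and the decay. -/
lemma norm_one_sub_branch_le (hr0 : 0 < r) (hr1 : r ≤ 1) (ht : 0 < t) (ha : 0 ≤ a) {z : ℂ}
    (hz : 0 < z.im) : ‖1 - branch r t a z‖ ≤ √(r * t) * ‖z‖ ^ (-(1 / 2) : ℝ) := by
  have h1 := (isBranch_branch hr0 hr1 ht ha hz).norm_sq_le hr0 hr1 ht ha hz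
  have hzn := norm_pos_iff.2 (ne_zero_of_im_pos hz)
  rw [Real.rpow_neg hzn.le, ← Real.sqrt_eq_rpow, ← div_eq_mul_inv, ← Real.sqrt_div (by positivity)]
  refine Real.le_sqrt_of_sq_le ?_
  rwa [le_div_iff₀ hzn]

lemma norm_branchGreen_le (hr0 : 0 < r) (hr1 : r ≤ 1) (ht : 0 < t) (ha : 0 ≤ a) {z : ℂ}
    (hz : 0 < z.im) :
    ‖branchGreen r t a z‖ ≤ √(r * t) / (r * t) * ‖z‖ ^ (-(1 / 2) : ℝ) := by
  have hrt : 0 < r * t := mul_pos hr0 ht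
  rw [branchGreen, norm_div, ← Complex.ofReal_mul, Complex.norm_real, Real.norm_of_nonneg hrt.le,
    div_mul_eq_mul_div]
  gcongr
  exact norm_one_sub_branch_le hr0 hr1 ht ha hz

lemma branchGreen_im (z : ℂ) :
    (branchGreen r t a z).im = -((branch r t a z).im / (r * t)) := by
  rw [branchGreen, ← Complex.ofReal_mul, Complex.div_ofReal_im, Complex.sub_im, Complex.one_im]
  ring

lemma differentiableAt_branchGreen (hr0 : 0 < r) (hr1 : r ≤ 1) (ht : 0 < t) (ha : 0 ≤ a) {z : ℂ}
    (hz : 0 < z.im) : DifferentiableAt ℂ (branchGreen r t a) z :=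
  ((differentiableAt_branch hr0 hr1 ht ha hz).const_sub 1).div_const _

lemma tendsto_branchGreen_im (hr0 : 0 < r) (hr1 : r ≤ 1) (ht : 0 < t) (ha : 0 ≤ a) {xL xR : ℝ}
    (hL : 0 ≤ xL) (hneg : ∀ x ∈ Set.Ioo xL xR, mpS x r t a < 0)
    (hpos : ∀ x, 0 < x → x ∉ Set.Ioo xL xR → 0 ≤ mpS x r t a) {x : ℝ} (hx : x ≠ 0) :
    Tendsto (fun ε : ℝ => -(1 / Real.pi) * (branchGreen r t a (x + ε * Complex.I)).im) (𝓝[>] 0)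
      (𝓝 (mpFormula r t a xL xR x)) := by
  have h := (tendsto_branch_im hr0 hr1 ht ha hL hneg hpos hx).const_mul (1 / (Real.pi * (r * t)))
  have hpi := Real.pi_ne_zero
  have e : 1 / (Real.pi * (r * t)) * (Real.pi * r * t * mpFormula r t a xL xR x)
      = mpFormula r t a xL xR x := by
    field_simp
  rw [e] at h
  refine h.congr fun ε => ?_
  rw [branchGreen_im]
  field_simp

lemma mpFormula_nonneg (hr0 : 0 < r) (ht : 0 < t) {xL xR : ℝ} (hL : 0 ≤ xL) (x : ℝ) :
    0 ≤ mpFormula r t a xL xR x := by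
  refine Set.indicator_nonneg (fun x hx => ?_) x
  have : 0 < x := lt_of_le_of_lt hL hx.1
  have := Real.pi_pos
  positivity

lemma ae_ne_zero : ∀ᵐ x : ℝ, x ≠ 0 := by simp [ae_iff]

/-- Measurability comes from the formula being an almost everywhere limit of continuous functions.
The bound on `G` passes to the limit and gives a multiple of `|x| ^ (-1/2)` on a bounded support. -/
lemma integrable_mpFormula (hr0 : 0 < r) (hr1 : r ≤ 1) (ht : 0 < t) (ha : 0 ≤ a) {xL xR : ℝ}
    (hL : 0 ≤ xL) (hneg : ∀ x ∈ Set.Ioo xL xR, mpS x r t a < 0)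
    (hpos : ∀ x, 0 < x → x ∉ Set.Ioo xL xR → 0 ≤ mpS x r t a) :
    Integrable (mpFormula r t a xL xR) := by
  have hpi := Real.pi_pos
  have him : ∀ (x : ℝ) {ε : ℝ}, 0 < ε → 0 < ((x : ℂ) + ε * Complex.I).im := by
    intro x ε hε; simpa using hε
  have hmeas : AEStronglyMeasurable (mpFormula r t a xL xR) := by
    have hseq : Tendsto (fun n : ℕ => 1 / ((n : ℝ) + 1)) atTop (𝓝[>] 0) :=
      tendsto_nhdsWithin_iff.2 ⟨tendsto_one_div_add_atTop_nhds_zero_nat,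
        Eventually.of_forall fun n => by
          have : 0 < 1 / ((n : ℝ) + 1) := by positivity
          exact this⟩
    refine aestronglyMeasurable_of_tendsto_ae atTop (f := fun (n : ℕ) (x : ℝ) =>
      -(1 / Real.pi) * (branchGreen r t a (x + ((1 / ((n : ℝ) + 1) : ℝ) : ℂ) * Complex.I)).im)
      (fun n => ?_) ?_
    · refine Continuous.aestronglyMeasurable (continuous_const.mul (Complex.continuous_im.comp ?_))
      refine continuous_iff_continuousAt.2 fun x => ?_
      have hd := differentiableAt_branchGreen hr0 hr1 ht ha
        (him x (ε := 1 / ((n : ℝ) + 1)) (by positivity))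
      exact ContinuousAt.comp (g := branchGreen r t a)
        (f := fun x : ℝ => (x : ℂ) + ((1 / ((n : ℝ) + 1) : ℝ) : ℂ) * Complex.I)
        hd.continuousAt (by fun_prop)
    · filter_upwards [ae_ne_zero] with x hx
      exact (tendsto_branchGreen_im hr0 hr1 ht ha hL hneg hpos hx).comp hseq
  set C := √(r * t) / (r * t) with hC
  have hC0 : 0 ≤ C := by positivity
  refine (integrable_abs_rpow_mul_inv.const_mul (1 / Real.pi * C * (1 + |xR|))).mono' hmeas ?_
  filter_upwards [ae_ne_zero] with x hx
  rw [Real.norm_of_nonneg (mpFormula_nonneg hr0 ht hL x)]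
  by_cases hmem : x ∈ Set.Ioo xL xR
  · have hx0 : 0 < x := lt_of_le_of_lt hL hmem.1
    have h1 : mpFormula r t a xL xR x ≤ 1 / Real.pi * (C * |x| ^ (-(1 / 2) : ℝ)) := by
      refine le_of_tendsto (tendsto_branchGreen_im hr0 hr1 ht ha hL hneg hpos hx) ?_
      filter_upwards [self_mem_nhdsWithin] with ε hε
      have hz := him x hε
      have h2 := norm_branchGreen_le hr0 hr1 ht ha hz
      have h3 : |x| ≤ ‖(x : ℂ) + ε * Complex.I‖ := by
        have := Complex.abs_re_le_norm ((x : ℂ) + ε * Complex.I)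
        simpa using this
      have h4 : ‖(x : ℂ) + ε * Complex.I‖ ^ (-(1 / 2) : ℝ) ≤ |x| ^ (-(1 / 2) : ℝ) :=
        Real.rpow_le_rpow_of_nonpos (abs_pos.2 hx) h3 (by norm_num)
      have h5 := (neg_le_abs _).trans (Complex.abs_im_le_norm
        (branchGreen r t a (x + ε * Complex.I)))
      rw [neg_mul, ← mul_neg]
      gcongr
      exact h5.trans (h2.trans (by gcongr))
    refine h1.trans ?_
    have h6 : 1 ≤ (1 + |xR|) * (1 + |x|)⁻¹ := by
      rw [← div_eq_mul_inv, le_div_iff₀ (by positivity), one_mul, abs_of_pos hx0]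
      have := le_abs_self xR
      linarith [hmem.2]
    calc 1 / Real.pi * (C * |x| ^ (-(1 / 2) : ℝ))
        = 1 / Real.pi * (C * |x| ^ (-(1 / 2) : ℝ)) * 1 := (mul_one _).symm
      _ ≤ 1 / Real.pi * (C * |x| ^ (-(1 / 2) : ℝ)) * ((1 + |xR|) * (1 + |x|)⁻¹) := by gcongr
      _ = _ := by ring
  · rw [mpFormula, Set.indicator_of_notMem hmem]
    positivity

/-- The equation rearranges to `z G = (1 + G ((1 - r) t + a / w)) / w`, where `G → 0` and `w → 1`.
Compared with `tendsto_mul_greenFn`, this fixes the total mass. -/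
lemma tendsto_mul_branchGreen (hr0 : 0 < r) (hr1 : r ≤ 1) (ht : 0 < t) (ha : 0 ≤ a) :
    Tendsto (fun y : ℝ => (y * Complex.I : ℂ) * branchGreen r t a (y * Complex.I)) atTop
      (𝓝 1) := by
  have hnorm : ∀ y : ℝ, 0 < y → ‖(y * Complex.I : ℂ)‖ = y := fun y hy => by
    simp [abs_of_pos hy]
  have him : ∀ y : ℝ, 0 < y → 0 < (y * Complex.I : ℂ).im := fun y hy => by simpa using hy
  have hw : Tendsto (fun y : ℝ => branch r t a (y * Complex.I)) atTop (𝓝 1) := by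
    rw [tendsto_iff_norm_sub_tendsto_zero]
    have h0 : Tendsto (fun y : ℝ => √(r * t) * y ^ (-(1 / 2) : ℝ)) atTop (𝓝 0) := by
      simpa using (tendsto_rpow_neg_atTop (y := 1 / 2) (by norm_num)).const_mul (√(r * t))
    refine squeeze_zero' (Eventually.of_forall fun y => norm_nonneg _) ?_ h0
    filter_upwards [eventually_gt_atTop 0] with y hy
    have := norm_one_sub_branch_le hr0 hr1 ht ha (him y hy)
    rwa [hnorm y hy, norm_sub_rev] at this
  have hF : Tendsto (fun y : ℝ => branchGreen r t a (y * Complex.I)) atTop (𝓝 0) := by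
    have := (tendsto_const_nhds (x := (1 : ℂ))).sub hw |>.div_const (r * t : ℂ)
    simpa [branchGreen] using this
  have hlim : Tendsto (fun y : ℝ => (1 + branchGreen r t a (y * Complex.I) * ((1 - r) * t
      + a / branch r t a (y * Complex.I))) / branch r t a (y * Complex.I)) atTop (𝓝 1) := by
    have h1 := ((hF.mul (((tendsto_const_nhds (x := (a : ℂ))).div hw one_ne_zero).const_add
      ((1 - r) * t : ℂ))).const_add 1).div hw one_ne_zero
    rw [zero_mul, add_zero, div_one] at h1
    exact h1
  refine hlim.congr' ?_
  filter_upwards [eventually_gt_atTop 0] with y hy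
  have hb := isBranch_branch hr0 hr1 ht ha (him y hy)
  have hw0 := ne_zero_of_im_pos hb.im_pos
  have heq := hb.eq
  have hr : (r : ℂ) ≠ 0 := by exact_mod_cast hr0.ne'
  have ht' : (t : ℂ) ≠ 0 := by exact_mod_cast ht.ne'
  rw [branchGreen]
  generalize branch r t a (y * Complex.I) = w at *
  generalize (y * Complex.I : ℂ) = z at *
  field_simp at heq ⊢
  linear_combination -heq

lemma tendsto_mul_greenFn {ρ : ℝ → ℝ} (hρ : Integrable ρ) :
    Tendsto (fun y : ℝ => (y * Complex.I : ℂ) * greenFn ρ (y * Complex.I)) atTop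
      (𝓝 ((∫ x, ρ x : ℝ) : ℂ)) := by
  have hne : ∀ {y : ℝ}, 0 < y → (y * Complex.I : ℂ).im ≠ 0 := fun {y} hy => by simpa using hy.ne'
  have e : ∀ y : ℝ, (y * Complex.I : ℂ) * greenFn ρ (y * Complex.I)
      = ∫ x, (y * Complex.I : ℂ) * ((ρ x : ℂ) / (y * Complex.I - x)) := fun y => by
    rw [greenFn, integral_const_mul]
  simp only [e]
  rw [← integral_complex_ofReal]
  refine tendsto_integral_filter_of_dominated_convergence (fun x => |ρ x|) ?_ ?_ hρ.abs
    (Eventually.of_forall fun x => ?_)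
  · filter_upwards [eventually_gt_atTop 0] with y hy
    exact (integrable_greenFn hρ (hne hy)).aestronglyMeasurable.const_mul _
  · filter_upwards [eventually_gt_atTop 0] with y hy
    refine Eventually.of_forall fun x => ?_
    have h1 := norm_div_sub_le (ρ x) (hne hy) x
    have him : (y * Complex.I : ℂ).im = y := by simp
    rw [him, abs_of_pos hy] at h1
    have h2 : ‖(y * Complex.I : ℂ)‖ = y := by simp [abs_of_pos hy]
    rw [norm_mul, h2]
    calc y * ‖(ρ x : ℂ) / (y * Complex.I - x)‖ ≤ y * (y⁻¹ * |ρ x|) := by gcongr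
      _ = |ρ x| := by field_simp
  · have h0 : Tendsto (fun y : ℝ => (ρ x : ℂ) / (1 + (x : ℂ) * Complex.I * ((y⁻¹ : ℝ) : ℂ))) atTop
        (𝓝 ((ρ x : ℂ) / (1 + (x : ℂ) * Complex.I * ((0 : ℝ) : ℂ)))) := by
      refine tendsto_const_nhds.div (tendsto_const_nhds.add (tendsto_const_nhds.mul
        ((Complex.continuous_ofReal.tendsto 0).comp tendsto_inv_atTop_zero))) (by simp)
    simp only [Complex.ofReal_zero, mul_zero, add_zero, div_one] at h0
    refine h0.congr' ?_
    filter_upwards [eventually_gt_atTop 0] with y hy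
    have hy' : (y : ℂ) ≠ 0 := by exact_mod_cast hy.ne'
    have h3 := sub_real_ne_zero (hne hy) x
    have h4 : (y * Complex.I : ℂ) - x = y * Complex.I * (1 + (x : ℂ) * Complex.I * (y : ℂ)⁻¹) := by
      field_simp
      linear_combination -(x : ℂ) * Complex.I_sq
    have hI := Complex.I_ne_zero
    rw [h4] at h3 ⊢
    have h5 := (mul_ne_zero_iff.1 h3).2
    push_cast
    field_simp

lemma greenFn_mpFormula (hr0 : 0 < r) (hr1 : r ≤ 1) (ht : 0 < t) (ha : 0 ≤ a) {xL xR : ℝ}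
    (hL : 0 ≤ xL) (hneg : ∀ x ∈ Set.Ioo xL xR, mpS x r t a < 0)
    (hpos : ∀ x, 0 < x → x ∉ Set.Ioo xL xR → 0 ≤ mpS x r t a) {z : ℂ} (hz : 0 < z.im) :
    greenFn (mpFormula r t a xL xR) z = branchGreen r t a z :=
  (eq_greenFn_of_boundary (fun _ hz => differentiableAt_branchGreen hr0 hr1 ht ha hz)
    (fun _ hz => norm_branchGreen_le hr0 hr1 ht ha hz)
    (fun _ hx => tendsto_branchGreen_im hr0 hr1 ht ha hL hneg hpos hx) hz).symm

lemma isMPDensity_mpFormula (hr0 : 0 < r) (hr1 : r ≤ 1) (ht : 0 < t) (ha : 0 ≤ a) {xL xR : ℝ}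
    (hL : 0 ≤ xL) (hneg : ∀ x ∈ Set.Ioo xL xR, mpS x r t a < 0)
    (hpos : ∀ x, 0 < x → x ∉ Set.Ioo xL xR → 0 ≤ mpS x r t a) :
    IsMPDensity r t a (mpFormula r t a xL xR) := by
  have hint := integrable_mpFormula hr0 hr1 ht ha hL hneg hpos
  have hup : ∀ z : ℂ, 0 < z.im →
      z = 1 / greenFn (mpFormula r t a xL xR) z
        + (t : ℂ) / (1 - (r : ℂ) * (t : ℂ) * greenFn (mpFormula r t a xL xR) z)
        + (a : ℂ) / (1 - (r : ℂ) * (t : ℂ) * greenFn (mpFormula r t a xL xR) z) ^ 2 := by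
    intro z hz
    have hb := isBranch_branch hr0 hr1 ht ha hz
    rw [greenFn_mpFormula hr0 hr1 ht ha hL hneg hpos hz]
    exact green_eq_of_eq hr0 ht (ne_zero_of_im_pos hb.im_pos) hb.eq
  refine ⟨mpFormula_nonneg hr0 ht hL, hint, ?_, fun z hz => ?_⟩
  · have h1 := tendsto_mul_greenFn hint
    have h2 : Tendsto (fun y : ℝ => (y * Complex.I : ℂ)
        * greenFn (mpFormula r t a xL xR) (y * Complex.I)) atTop (𝓝 1) := by
      refine (tendsto_mul_branchGreen hr0 hr1 ht ha).congr' ?_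
      filter_upwards [eventually_gt_atTop 0] with y hy
      rw [greenFn_mpFormula hr0 hr1 ht ha hL hneg hpos (by simpa using hy)]
    exact_mod_cast tendsto_nhds_unique h1 h2
  -- The density and the parameters are real, so conjugation carries the equation to the lower
  -- half-plane.
  · rcases lt_or_gt_of_ne hz with hz | hz
    · have h1 := hup ((starRingEnd ℂ) z) (by simpa using hz)
      rw [greenFn_conj] at h1
      have h2 := congrArg (starRingEnd ℂ) h1
      simpa using h2
    · exact hup z hz

/-- The compactness argument for the branch excludes `z = 0`. If `x_L > 0`, the support avoids `0`
and the Poisson kernel on it is at most `ε / x_L²`. -/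
lemma tendsto_greenFn_im_zero {xL xR : ℝ} (hr0 : 0 < r) (ht : 0 < t) (hL : 0 < xL)
    (hint : Integrable (mpFormula r t a xL xR)) :
    Tendsto (fun ε : ℝ => (greenFn (mpFormula r t a xL xR) (ε * Complex.I)).im) (𝓝[>] 0)
      (𝓝 0) := by
  have hlim : Tendsto (fun ε : ℝ => ε / xL ^ 2 * ∫ x, mpFormula r t a xL xR x) (𝓝[>] 0) (𝓝 0) := by
    have : Continuous fun ε : ℝ => ε / xL ^ 2 * ∫ x, mpFormula r t a xL xR x := by fun_prop
    have := this.tendsto 0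
    simp only [zero_div, zero_mul] at this
    exact this.mono_left nhdsWithin_le_nhds
  refine squeeze_zero_norm' ?_ hlim
  filter_upwards [self_mem_nhdsWithin] with ε hε
  have hε0 : 0 < ε := hε
  have hz : (ε * Complex.I : ℂ).im ≠ 0 := by simpa using hε0.ne'
  rw [greenFn_im hint hz, norm_neg, ← integral_const_mul]
  refine norm_integral_le_of_norm_le (hint.const_mul _) (Eventually.of_forall fun x => ?_)
  have hre : (ε * Complex.I : ℂ).re = 0 := by simp
  have him : (ε * Complex.I : ℂ).im = ε := by simp
  rw [hre, him, sub_zero, norm_mul, Real.norm_of_nonneg (mpFormula_nonneg hr0 ht hL.le x),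
    Real.norm_of_nonneg (by positivity), mul_comm]
  by_cases hmem : x ∈ Set.Ioo xL xR
  · refine mul_le_mul_of_nonneg_right ?_ (mpFormula_nonneg hr0 ht hL.le x)
    have : xL ^ 2 ≤ x ^ 2 + ε ^ 2 := by nlinarith [hmem.1]
    gcongr
  · rw [mpFormula, Set.indicator_of_notMem hmem, mul_zero, mul_zero]

end Assembly

theorem theorem1 (r t a : ℝ) (hr0 : 0 < r) (hr1 : r ≤ 1) (ht : 0 < t) (ha : 0 ≤ a) :
    ∃ xL xR : ℝ,
      -- the support endpoints are the two largest real roots of the cubic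
      IsTwoLargestRoots (mpCubic r t a) xL xR ∧ 0 ≤ xL ∧ xL < xR ∧
      -- on the support every real root in the formula is taken of an admissible number
      (∀ x ∈ Set.Ioo xL xR,
        mpS x r t a < 0 ∧ 0 < mpG x r t a ∧
        (mpFL x r t a).im = 0 ∧ (mpFR x r t a).im = 0 ∧
        (mpFL x r t a).re < x ∧ x < (mpFR x r t a).re) ∧
      -- the formula is the MP density, and the algebraic equation determines the latter
      IsMPDensity r t a (mpFormula r t a xL xR) ∧
      (∀ ρ : ℝ → ℝ, IsMPDensity r t a ρ →
        ρ =ᵐ[volume] mpFormula r t a xL xR ∧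
        -- pointwise, through the boundary values of the Green's function
        ∀ x : ℝ, (x ≠ 0 ∨ 0 < xL) →
          Tendsto (fun ε : ℝ =>
              -(1 / Real.pi) * (greenFn ρ ((x : ℂ) + (ε : ℂ) * Complex.I)).im)
            (𝓝[>] 0) (𝓝 (mpFormula r t a xL xR x))) := by
  obtain ⟨xL, xR, hroots, hL, hLR, hneg, hpos⟩ := exists_support hr0 hr1 ht ha
  have hMP := isMPDensity_mpFormula hr0 hr1 ht ha hL hneg hpos
  refine ⟨xL, xR, hroots, hL, hLR, fun x hx => ?_, hMP, fun ρ hρ => ⟨?_, fun x hx => ?_⟩⟩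
  · have hx0 : 0 < x := lt_of_le_of_lt hL hx.1
    obtain ⟨w₁, s, p, hf, hw₁, hs, hp⟩ := exists_cubicFactor hr1 ht ha hx0 (hneg x hx)
    obtain ⟨h1, h2, h3, h4, -⟩ := hf.density_part ht ha hx0 hw₁ hs hp
    exact ⟨hneg x hx, hf.mpG_pos hx0 hw₁ hs hp, h1, h2, h3, h4⟩
  · refine ae_eq_of_greenFn_eq hρ.integrable hMP.integrable fun z hz => ?_
    rw [hρ.greenFn_eq hr0 hr1 ht ha hz, hMP.greenFn_eq hr0 hr1 ht ha hz]
  · rcases eq_or_ne x 0 with rfl | hx0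
    · have hL0 : 0 < xL := hx.resolve_left fun h => h rfl
      have h1 := (tendsto_greenFn_im_zero hr0 ht hL0 hMP.integrable).const_mul (-(1 / Real.pi))
      rw [mpFormula, Set.indicator_of_notMem fun h => by linarith [h.1]]
      rw [mul_zero] at h1
      refine h1.congr' ?_
      filter_upwards [self_mem_nhdsWithin] with ε hε
      have hz : 0 < (ε * Complex.I : ℂ).im := by simpa using hε
      rw [Complex.ofReal_zero, zero_add, hρ.greenFn_eq hr0 hr1 ht ha hz,
        hMP.greenFn_eq hr0 hr1 ht ha hz]
    · refine (tendsto_branchGreen_im hr0 hr1 ht ha hL hneg hpos hx0).congr' ?_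
      filter_upwards [self_mem_nhdsWithin] with ε hε
      rw [hρ.greenFn_eq hr0 hr1 ht ha (by simpa using hε)]
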